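/- Let $1\le k\le n$ be integers. Let $f:\mathbb R^n\to\mathbb R$ be continuously differentiable with $\|\nabla f(x)-\nabla f(x')\|\le L\|x-x'\|$ for all $x,x'$, where $L>0$, and let $\inf f>-\infty$. Let $\theta\in(0,1)$ and assume that $f$ satisfies the Łojasiewicz inequality with exponent $\theta$: for every $x^*$ with $\nabla f(x^*)=0$ there are $\kappa,\mu>0$ such that $|f(x)-f(x^*)|^\theta\le\kappa\|\nabla f(x)\|$ whenever $\|x-x^*\|\le\mu$. Let $V_0,V_1,\dots$ be independent random matrices, $V_t=[v_{t,1},\dots,v_{t,k}]$, uniformly distributed on the Stiefel manifold $\{V\in\mathbb R^{n\times k}:V^\top V=I_k\}$ (i.e. with the $O(n)$-invariant probability distribution on it). Fix $x_0\in\mathbb R^n$, $\delta_0\in(0,1]$ and a constant step size $\eta$ with $0<\eta<\frac{2k}{Ln}$. With $\delta_t=2^{-t}\delta_0$, let SZGD generate $$x_{t+1}=x_t-\eta\,\frac{n}{2\delta_t k}\sum_{i=1}^k\bigl(f(x_t+\delta_t v_{t,i})-f(x_t-\delta_t v_{t,i})\bigr)v_{t,i},\qquad t=0,1,2,\dots,$$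 and assume that almost surely the sequence $(x_t)_t$ is bounded. Then there is a random vector $x_\infty$ such that, almost surely, $x_t\to x_\infty$ and $\nabla f(x_\infty)=0$. Moreover: (a) Suppose $\theta\in(0,\frac12]$ and $-1\le\frac{Ln\eta^2}{2k}-\eta<0$. Then almost surely there is $Q>1$ (possibly depending on the outcome) with $Q^t\,(f(x_t)-f(x_\infty))\to0$. If, in addition, either one and the same constant $\kappa$ can be used in the Łojasiewicz inequality at all critical points (for instance $\kappa=1$; the radius $\mu$ may still vary), or there is a non-random $R$ with $\|x_t\|\le R$ for all $t$ almost surely, then there is a non-random constant $Q>1$ such that $Q^t\,(f(x_t)-f(x_\infty))\to0$ almost surely. (b) If $\theta\in(\frac12,1)$, then almost surely $f(x_t)-f(x_\infty)=O\bigl(t^{1/(1-2\theta)}\bigr)$ as $t\to\infty$. -/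

import Mathlib

open MeasureTheory ProbabilityTheory Filter Topology Asymptotics

namespace SZGD

noncomputable section

/-- Euclidean space `ℝⁿ`. -/
abbrev E (n : ℕ) : Type := EuclideanSpace ℝ (Fin n)

/-- `L`-smoothness: continuously differentiable with `L`-Lipschitz gradient. -/
def LSmooth {n : ℕ} (L : ℝ) (f : E n → ℝ) : Prop :=
  ContDiff ℝ 1 f ∧ ∀ x x' : E n, ‖gradient f x - gradient f x'‖ ≤ L * ‖x - x'‖

/-- The Łojasiewicz inequality with exponent `θ` and constant `κ`
on some closed ball centred at `xs`. -/
def LojasiewiczAt {n : ℕ} (θ κ : ℝ) (f : E n → ℝ) (xs : E n) : Prop :=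
  ∃ μ : ℝ, 0 < μ ∧ ∀ x : E n, ‖x - xs‖ ≤ μ → |f x - f xs| ^ θ ≤ κ * ‖gradient f x‖

/-- Differentiable Łojasiewicz function with exponent `θ ∈ (0,1)`; both `κ` and the radius
may depend on the critical point. -/
def IsLojasiewicz {n : ℕ} (θ : ℝ) (f : E n → ℝ) : Prop :=
  0 < θ ∧ θ < 1 ∧ Differentiable ℝ f ∧
    ∀ xs : E n, gradient f xs = 0 → ∃ κ : ℝ, 0 < κ ∧ LojasiewiczAt θ κ f xs

/-- The constant `κ` of the Łojasiewicz inequality can be chosen to be the same at all critical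
points (the radius may still vary); `κ = 1` is the usual normalisation. -/
def HasUniformLojasiewiczConstant {n : ℕ} (θ : ℝ) (f : E n → ℝ) : Prop :=
  ∃ κ : ℝ, 0 < κ ∧ ∀ xs : E n, gradient f xs = 0 → LojasiewiczAt θ κ f xs

/-- The Stiefel manifold `St(n,k)`: an `n × k` matrix with `Vᵀ V = I` is
given by its `k` columns, which are orthonormal. -/
def stiefel (n k : ℕ) : Set (Fin k → E n) := {V | Orthonormal ℝ V}

/-- `ν` is the uniform distribution on `St(n,k)`: the (unique) probability measure carried by
`St(n,k)` and invariant under the transitive action `V ↦ U V` of the orthogonal group. -/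
structure IsStiefelUniform {n k : ℕ} (ν : Measure (Fin k → E n)) : Prop where
  isProbabilityMeasure : IsProbabilityMeasure ν
  ae_mem : ∀ᵐ V ∂ν, V ∈ stiefel n k
  invariant : ∀ U : E n ≃ₗᵢ[ℝ] E n, ν.map (fun V i => U (V i)) = ν

/-- The uniform distribution on `St(n,k)` exists for `k ≤ n`. -/
theorem exists_isStiefelUniform {n k : ℕ} (hkn : k ≤ n) :
    ∃ ν : Measure (Fin k → E n), IsStiefelUniform ν := by
  have : ContinuousStar (E n →L[ℝ] E n) :=
    ⟨(ContinuousLinearMap.adjoint (𝕜 := ℝ) (E := E n) (F := E n)).continuous⟩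
  let G := unitary (E n →L[ℝ] E n)
  have hc : IsCompact (G : Set (E n →L[ℝ] E n)) := by
    have : ProperSpace (E n →L[ℝ] E n) := FiniteDimensional.proper ℝ _
    refine (isCompact_closedBall (0 : E n →L[ℝ] E n) 1).of_isClosed_subset isClosed_unitary ?_
    intro A hA
    rw [mem_closedBall_zero_iff]
    exact ContinuousLinearMap.opNorm_le_bound _ zero_le_one fun x => by
      simpa using (Unitary.norm_map (⟨A, hA⟩ : G) x).le
  have : CompactSpace G := isCompact_iff_compactSpace.mp hc
  let : MeasurableSpace G := borel G
  have : BorelSpace G := ⟨rfl⟩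
  let μ : Measure G := Measure.haarMeasure ⊤
  have : IsProbabilityMeasure μ := 
    ⟨Measure.haarMeasure_self (K₀ := (⊤ : TopologicalSpace.PositiveCompacts G))⟩
  let e : Fin k → E n := fun i => EuclideanSpace.basisFun (Fin n) ℝ (Fin.castLE hkn i)
  have he : Orthonormal ℝ e :=
    (EuclideanSpace.basisFun (Fin n) ℝ).orthonormal.comp _ (Fin.castLE_injective hkn)
  let φ : G → Fin k → E n := fun A i => A.1 (e i)
  have hφ : Continuous φ := by fun_prop
  refine ⟨μ.map φ, Measure.isProbabilityMeasure_map hφ.aemeasurable, ?_, ?_⟩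
  · refine (ae_map_iff hφ.aemeasurable ?_).2 (ae_of_all _ fun A => ?_)
    · have hS : IsClosed (stiefel n k) := by
        simp only [stiefel, orthonormal_iff_ite, Set.ofPred_forall]
        exact isClosed_iInter fun i => isClosed_iInter fun j =>
          isClosed_eq (by fun_prop) continuous_const
      exact hS.measurableSet
    · exact he.comp_linearIsometryEquiv (Unitary.linearIsometryEquiv A)
  · intro U
    have hU : Measurable (fun (V : Fin k → E n) i => U (V i)) := by fun_prop
    rw [Measure.map_map hU hφ.measurable]
    let g : G := Unitary.linearIsometryEquiv.symm U
    have : (fun (V : Fin k → E n) i => U (V i)) ∘ φ = φ ∘ (fun A => g * A) := by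
      funext A i
      simp [φ, g]
    rw [this, ← Measure.map_map hφ.measurable (measurable_const_mul g), map_mul_left_eq_self]

/-- The finite-difference gradient estimator with granularity `δ` and directions `v₁, …, v_k`. -/
def gradEst {n k : ℕ} (f : E n → ℝ) (δ : ℝ) (v : Fin k → E n) (x : E n) : E n :=
  ((n : ℝ) / (2 * δ * k)) • ∑ i, (f (x + δ • v i) - f (x - δ • v i)) • v i

/-- The SZGD iterates with constant step size `η`, granularity `δ_t = δ₀ 2^{-t}`, starting point
`x₀`, and direction frames `v 0, v 1, …`. -/
def szgd {n k : ℕ} (f : E n → ℝ) (η δ₀ : ℝ) (x₀ : E n) (v : ℕ → Fin k → E n) : ℕ → E n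
  | 0 => x₀
  | t + 1 => szgd f η δ₀ x₀ v t - η • gradEst f (δ₀ / 2 ^ t) (v t) (szgd f η δ₀ x₀ v t)

/-- The frames `V_0, V_1, …` are independent and uniformly distributed on `St(n,k)`. -/
structure IsStiefelSample {n k : ℕ} {Ω : Type*} [MeasurableSpace Ω] (P : Measure Ω)
    (V : ℕ → Ω → Fin k → E n) : Prop where
  measurable : ∀ t, Measurable (V t)
  uniform : ∀ t, IsStiefelUniform (P.map (V t))
  indep : iIndepFun V P

end

end SZGD

/-!
Central differences along an orthonormal frame approximate the corresponding components of the
gradient, so one SZGD step decreases `f` by `c * w t * ‖∇f (x t)‖ ^ 2` up to a geometrically small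
error, where `w t ∈ [0, 1]` is the fraction of the squared gradient seen by the frame `V t`. By
invariance, `w t` has conditional mean `k / n` given the past. Hence sums weighted by `w` are almost
surely finite only if the unweighted sums are, and `∏ (1 - r * w t)` decays exponentially. The first
fact turns the usual Łojasiewicz argument for `∑ w t * ‖∇f (x t)‖ < ∞` into finite length of the
path; the second one replaces deterministic contraction in the rates.
-/

namespace SZGD

/-! ### Scalar recursions -/

section Recursion

variable {a b β r s θ : ℝ} {p u : ℕ → ℝ}

theorem one_sub_mul_sub_le_rpow_mul_sub (ha : 0 ≤ a) (hb : 0 ≤ b) (hθ₀ : 0 ≤ θ) (hθ₁ : θ ≤ 1) :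
    (1 - θ) * (a - b) ≤ a ^ θ * (a ^ (1 - θ) - b ^ (1 - θ)) := by
  have h_amgm : a ^ θ * b ^ (1 - θ) ≤ θ * a + (1 - θ) * b :=
    Real.geom_mean_le_arith_mean2_weighted hθ₀ (sub_nonneg.2 hθ₁) ha hb (add_sub_cancel θ 1)
  have h_self : a ^ θ * a ^ (1 - θ) = a := by
    rw [← Real.rpow_add' ha (by simp), add_sub_cancel, Real.rpow_one]
  rw [mul_sub (a ^ θ), h_self]
  linarith

theorem rpow_neg_add_mul_le_rpow_neg (ha : 0 < a) (hb : 0 < b) (hβ : 0 ≤ β)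
    (hab : b ≤ a - s * a ^ (1 + β)) : a ^ (-β) + β * s ≤ b ^ (-β) := by
  have h_pow : a ^ (-β) * a ^ β = 1 := by rw [← Real.rpow_add ha, neg_add_cancel, Real.rpow_zero]
  have h_ratio : b / a ≤ 1 - s * a ^ β := by
    rw [Real.rpow_add ha, Real.rpow_one] at hab
    rw [div_le_iff₀ ha]
    linarith
  have h_log : Real.log (b / a) ≤ -(s * a ^ β) := by
    linarith [Real.log_le_sub_one_of_pos (div_pos hb ha)]
  have h_exp : 1 + β * (s * a ^ β) ≤ (b / a) ^ (-β) := by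
    rw [Real.rpow_def_of_pos (div_pos hb ha)]
    nlinarith [Real.add_one_le_exp (Real.log (b / a) * -β)]
  calc a ^ (-β) + β * s = a ^ (-β) * (1 + β * (s * a ^ β)) := by linear_combination -(β * s) * h_pow
    _ ≤ a ^ (-β) * (b / a) ^ (-β) := by gcongr
    _ = b ^ (-β) := by rw [← Real.mul_rpow ha.le (by positivity), mul_div_cancel₀ _ ha.ne']

theorem mul_sum_Ico_le_rpow_neg {T t : ℕ} (hu : ∀ t, 0 < u t) (hβ : 0 ≤ β)
    (hrec : ∀ t ≥ T, u (t + 1) ≤ u t - r * p t * u t ^ (1 + β)) (hTt : T ≤ t) :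
    β * r * ∑ s ∈ Finset.Ico T t, p s ≤ u t ^ (-β) := by
  induction t, hTt using Nat.le_induction with
  | base => simpa using Real.rpow_nonneg (hu T).le _
  | succ t hTt ih =>
    have := rpow_neg_add_mul_le_rpow_neg (hu t) (hu (t + 1)) hβ (hrec t hTt)
    rw [Finset.sum_Ico_succ_top hTt]
    linarith

/-- The sequence `p` has lower density at least `d > 0` for some `d`. -/
def HasPosLowerDensity (p : ℕ → ℝ) : Prop :=
  ∃ d > 0, ∀ᶠ t : ℕ in atTop, d * t ≤ ∑ s ∈ Finset.range t, p s

theorem HasPosLowerDensity.isBigO_rpow (hp : HasPosLowerDensity p) (hu : ∀ t, 0 < u t)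
    (hβ : 0 < β) (hr : 0 < r)
    (hrec : ∀ᶠ t in atTop, u (t + 1) ≤ u t - r * p t * u t ^ (1 + β)) :
    u =O[atTop] fun t : ℕ => (t : ℝ) ^ (-(1 / β)) := by
  obtain ⟨d, hd, hdens⟩ := hp
  obtain ⟨T, hT⟩ := eventually_atTop.1 hrec
  set q := β * r * (d / 2)
  have hq : 0 < q := by positivity
  have h_growth : ∀ᶠ t : ℕ in atTop, q * t ≤ u t ^ (-β) := by
    filter_upwards [hdens, eventually_ge_atTop T, tendsto_natCast_atTop_atTop.eventually_ge_atTop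
      (2 * (∑ s ∈ Finset.range T, p s) / d)] with t ht hTt ht_large
    refine le_trans ?_ (mul_sum_Ico_le_rpow_neg hu hβ.le hT hTt)
    rw [div_le_iff₀ hd] at ht_large
    rw [Finset.sum_Ico_eq_sub _ hTt, mul_assoc (β * r)]
    gcongr
    linarith
  refine IsBigO.of_bound (q ^ (-(1 / β))) ?_
  filter_upwards [h_growth, eventually_gt_atTop 0] with t ht ht₀
  have ht₀ : (0 : ℝ) < t := by exact_mod_cast ht₀
  rw [Real.norm_of_nonneg (hu t).le, Real.norm_of_nonneg (by positivity)]
  calc u t = (u t ^ (-β)) ^ (-(1 / β)) := by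
        rw [← Real.rpow_mul (hu t).le, neg_mul_neg, mul_one_div_cancel hβ.ne', Real.rpow_one]
    _ ≤ (q * t) ^ (-(1 / β)) :=
        Real.rpow_le_rpow_of_nonpos (by positivity) ht (neg_nonpos.2 (by positivity))
    _ = q ^ (-(1 / β)) * (t : ℝ) ^ (-(1 / β)) := Real.mul_rpow hq.le ht₀.le

theorem hasPosLowerDensity_of_tendsto_pow_mul_prod {Q : ℝ} (hp₀ : ∀ t, 0 ≤ p t)
    (hp₁ : ∀ t, p t ≤ 1) (hr₀ : 0 < r) (hr₁ : r < 1) (hQ : 1 < Q)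
    (h : Tendsto (fun t : ℕ => Q ^ t * ∏ s ∈ Finset.range t, (1 - r * p s)) atTop (𝓝 0)) :
    HasPosLowerDensity p := by
  have hr : 0 < 1 - r := sub_pos.2 hr₁
  have h_log : 0 < -Real.log (1 - r) := neg_pos.2 (Real.log_neg hr (by linarith))
  refine ⟨Real.log Q / -Real.log (1 - r), div_pos (Real.log_pos hQ) h_log, ?_⟩
  filter_upwards [h.eventually_lt_const one_pos] with t ht
  have h_bernoulli : (1 - r) ^ (∑ s ∈ Finset.range t, p s) ≤
      ∏ s ∈ Finset.range t, (1 - r * p s) := by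
    rw [Real.rpow_sum_of_pos hr]
    refine Finset.prod_le_prod (fun s _ => by positivity) fun s _ => ?_
    have := rpow_one_add_le_one_add_mul_self (s := -r) (by linarith) (hp₀ s) (hp₁ s)
    rwa [← sub_eq_add_neg, mul_neg, ← sub_eq_add_neg, mul_comm] at this
  have h_le_one : Q ^ t * (1 - r) ^ (∑ s ∈ Finset.range t, p s) ≤ 1 :=
    (mul_le_mul_of_nonneg_left h_bernoulli (pow_nonneg (by linarith) t)).trans ht.le
  have hQ_pow : 0 < Q ^ t := pow_pos (by linarith) t
  have h_log_le := Real.log_nonpos (by positivity) h_le_one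
  rw [Real.log_mul hQ_pow.ne' (by positivity), Real.log_pow, Real.log_rpow hr] at h_log_le
  rw [div_mul_eq_mul_div, div_le_iff₀ h_log]
  linarith

theorem exists_eventually_le_mul_prod (hpos : ∀ t, 0 < 1 - r * p t)
    (hrec : ∀ᶠ t in atTop, u (t + 1) ≤ u t - r * p t * u t) :
    ∃ B, ∀ᶠ t in atTop, u t ≤ B * ∏ s ∈ Finset.range t, (1 - r * p s) := by
  obtain ⟨T, hT⟩ := eventually_atTop.1 hrec
  refine ⟨u T / ∏ s ∈ Finset.range T, (1 - r * p s), eventually_atTop.2 ⟨T, fun t ht => ?_⟩⟩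
  induction t, ht using Nat.le_induction with
  | base => rw [div_mul_cancel₀ _ (Finset.prod_pos fun s _ => hpos s).ne']
  | succ t ht ih =>
    rw [Finset.prod_range_succ, ← mul_assoc]
    calc u (t + 1) ≤ u t * (1 - r * p t) := by linarith [hT t ht]
      _ ≤ _ := mul_le_mul_of_nonneg_right ih (hpos t).le

theorem summable_sub_succ (hu : Antitone u) (hbdd : BddBelow (Set.range u)) :
    Summable fun t => u t - u (t + 1) := by
  obtain ⟨m, hm⟩ := hbdd
  refine summable_of_sum_range_le (c := u 0 - m) (fun t => sub_nonneg.2 (hu t.le_succ)) fun t => ?_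
  rw [Finset.sum_range_sub']
  linarith [hm ⟨t, rfl⟩]

end Recursion

/-! ### Descent up to a geometric error -/

/-- The values `φ t` of a function along a descent method decrease by at least `c * (p t * G t ^ 2)`
up to an error of order `4⁻ᵗ`. Here `G t` is the norm of the gradient, and `p t` is the fraction of
its squared norm seen by the step. -/
structure IsApproxDescent (c D : ℝ) (p G φ : ℕ → ℝ) : Prop where
  c_pos : 0 < c
  D_pos : 0 < D
  p_nonneg : ∀ t, 0 ≤ p t
  p_le_one : ∀ t, p t ≤ 1
  G_nonneg : ∀ t, 0 ≤ G t
  descent : ∀ t, φ (t + 1) ≤ φ t - c * (p t * G t ^ 2) + D / 2 / 4 ^ t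

/-- The excess of `φ t` over the value `ℓ`, augmented by a multiple of the future errors of an
approximate descent, so that it is decreasing. -/
noncomputable def excess (D : ℝ) (φ : ℕ → ℝ) (ℓ : ℝ) (t : ℕ) : ℝ := φ t - ℓ + D / 4 ^ t

theorem sqrt_div_four_pow (D : ℝ) (t : ℕ) : √(D / 4 ^ t) = √D * (1 / 2) ^ t := by
  rw [Real.sqrt_div' D (by positivity), show (4 : ℝ) = 2 ^ 2 by norm_num, pow_right_comm,
    Real.sqrt_sq (by positivity), one_div, inv_pow, div_eq_mul_inv]

theorem tendsto_div_four_pow (D : ℝ) : Tendsto (fun t : ℕ => D / (4 : ℝ) ^ t) atTop (𝓝 0) :=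
  tendsto_const_nhds.div_atTop (tendsto_pow_atTop_atTop_of_one_lt (by norm_num))

/-- The ratio `ρ` in the recursion `a (t + 1) ≤ a t - ρ * p t * a t ^ (2 * θ)` which descent with
constant `c` and the Łojasiewicz inequality with constant `κ` imply for the excess. -/
noncomputable def contraction (c κ : ℝ) : ℝ := 1 / (2 * κ ^ 2 / c + 8)

theorem contraction_pos {c : ℝ} (hc : 0 < c) (κ : ℝ) : 0 < contraction c κ := by
  unfold contraction; positivity

theorem contraction_lt_one {c : ℝ} (hc : 0 < c) (κ : ℝ) : contraction c κ < 1 := by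
  have : 0 ≤ 2 * κ ^ 2 / c := by positivity
  rw [contraction, div_lt_one (by positivity)]
  linarith

namespace IsApproxDescent

variable {c D ℓ κ θ : ℝ} {p G φ : ℕ → ℝ}

theorem decrease_nonneg (h : IsApproxDescent c D p G φ) (t : ℕ) : 0 ≤ c * (p t * G t ^ 2) :=
  mul_nonneg h.c_pos.le (mul_nonneg (h.p_nonneg t) (sq_nonneg _))

theorem one_sub_contraction_mul_pos (h : IsApproxDescent c D p G φ) (κ : ℝ) (t : ℕ) :
    0 < 1 - contraction c κ * p t := by
  nlinarith [contraction_pos h.c_pos κ, contraction_lt_one h.c_pos κ, h.p_nonneg t, h.p_le_one t]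

theorem excess_succ_add_le (h : IsApproxDescent c D p G φ) (ℓ : ℝ) (t : ℕ) :
    excess D φ ℓ (t + 1) + c * (p t * G t ^ 2) + D / 4 / 4 ^ t ≤ excess D φ ℓ t := by
  have h_descent := h.descent t
  rw [div_right_comm] at h_descent
  rw [excess, excess, pow_succ, ← div_div D, div_right_comm D 4]
  linarith

theorem decrease_le (h : IsApproxDescent c D p G φ) (ℓ : ℝ) (t : ℕ) :
    c * (p t * G t ^ 2) ≤ excess D φ ℓ t - excess D φ ℓ (t + 1) := by
  have := h.D_pos
  have : 0 < D / 4 / 4 ^ t := by positivity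
  linarith [h.excess_succ_add_le ℓ t]

theorem antitone_excess (h : IsApproxDescent c D p G φ) (ℓ : ℝ) : Antitone (excess D φ ℓ) :=
  antitone_nat_of_succ_le fun t => by linarith [h.decrease_le ℓ t, h.decrease_nonneg t]

theorem tendsto_excess (hφ : Tendsto φ atTop (𝓝 ℓ)) (D : ℝ) :
    Tendsto (excess D φ ℓ) atTop (𝓝 0) := by
  simpa [excess] using! (hφ.sub_const ℓ).add (tendsto_div_four_pow D)

theorem exists_tendsto (h : IsApproxDescent c D p G φ) (hφ : BddBelow (Set.range φ)) :
    ∃ ℓ, Tendsto φ atTop (𝓝 ℓ) := by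
  obtain ⟨m, hm⟩ := hφ
  have hbdd : BddBelow (Set.range (excess D φ m)) := by
    refine ⟨0, Set.forall_mem_range.2 fun t => ?_⟩
    have := h.D_pos
    exact add_nonneg (sub_nonneg.2 (hm ⟨t, rfl⟩)) (by positivity)
  have := (tendsto_atTop_ciInf (h.antitone_excess m) hbdd).sub (tendsto_div_four_pow D)
  exact ⟨_, by simpa [excess] using this.add_const m⟩

theorem div_four_pow_le_excess (h : IsApproxDescent c D p G φ) (hφ : Tendsto φ atTop (𝓝 ℓ))
    (t : ℕ) : D / 4 / 4 ^ t ≤ excess D φ ℓ t := by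
  linarith [h.excess_succ_add_le ℓ t, h.decrease_nonneg t,
    (h.antitone_excess ℓ).le_of_tendsto (tendsto_excess hφ D) (t + 1)]

theorem excess_pos (h : IsApproxDescent c D p G φ) (hφ : Tendsto φ atTop (𝓝 ℓ)) (t : ℕ) :
    0 < excess D φ ℓ t := by
  have := h.D_pos
  exact lt_of_lt_of_le (by positivity) (h.div_four_pow_le_excess hφ t)

theorem abs_sub_le_three_mul_excess (h : IsApproxDescent c D p G φ) (hφ : Tendsto φ atTop (𝓝 ℓ))
    (t : ℕ) : |φ t - ℓ| ≤ 3 * excess D φ ℓ t := by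
  have h_low := h.div_four_pow_le_excess hφ t
  have := h.D_pos
  have : 0 < D / 4 ^ t := by positivity
  rw [div_right_comm] at h_low
  simp only [excess] at h_low ⊢
  rw [abs_le]
  constructor <;> linarith

theorem summable_mul_sq (h : IsApproxDescent c D p G φ) (hφ : BddBelow (Set.range φ)) :
    Summable fun t => p t * G t ^ 2 := by
  obtain ⟨ℓ, hℓ⟩ := h.exists_tendsto hφ
  have h_sub := summable_sub_succ (h.antitone_excess ℓ)
    ⟨0, Set.forall_mem_range.2 fun t => (h.excess_pos hℓ t).le⟩
  exact (summable_mul_left_iff h.c_pos.ne').1 <|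
    h_sub.of_nonneg_of_le h.decrease_nonneg (h.decrease_le ℓ)

theorem eventually_excess_rpow_le (h : IsApproxDescent c D p G φ) (hφ : Tendsto φ atTop (𝓝 ℓ))
    (hθ : 1 / 2 ≤ θ) (hθ₁ : θ ≤ 1) (hloj : ∀ᶠ t in atTop, |φ t - ℓ| ^ θ ≤ κ * G t) :
    ∀ᶠ t in atTop, excess D φ ℓ t ^ θ ≤ κ * G t + √(D / 4 ^ t) := by
  have := h.D_pos
  filter_upwards [hloj, (tendsto_div_four_pow D).eventually_le_const one_pos] with t ht h_small
  have h_nonneg : 0 ≤ D / (4 : ℝ) ^ t := by positivity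
  calc excess D φ ℓ t ^ θ ≤ (|φ t - ℓ| + D / 4 ^ t) ^ θ :=
        Real.rpow_le_rpow (h.excess_pos hφ t).le (add_le_add_left (le_abs_self _) _) (by linarith)
    _ ≤ |φ t - ℓ| ^ θ + (D / 4 ^ t) ^ θ :=
        Real.rpow_add_le_add_rpow (abs_nonneg _) h_nonneg (by linarith) hθ₁
    _ ≤ κ * G t + √(D / 4 ^ t) := by
        rw [Real.sqrt_eq_rpow]
        exact add_le_add ht
          (Real.rpow_le_rpow_of_exponent_ge' h_nonneg h_small (by norm_num) hθ)

theorem mul_le_of_excess_rpow_le (h : IsApproxDescent c D p G φ) (hφ : Tendsto φ atTop (𝓝 ℓ))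
    (hθ : 0 ≤ θ) (hθ₁ : θ < 1) (hκ : 0 ≤ κ) {t : ℕ} (ht : excess D φ ℓ t ^ θ ≤ κ * G t) :
    p t * G t ≤
      κ / (c * (1 - θ)) * (excess D φ ℓ t ^ (1 - θ) - excess D φ ℓ (t + 1) ^ (1 - θ)) := by
  have hc := h.c_pos
  have h1θ : 0 < 1 - θ := sub_pos.2 hθ₁
  set a := excess D φ ℓ
  have ha : ∀ t, 0 < a t := h.excess_pos hφ
  refine le_of_mul_le_mul_right ?_ (Real.rpow_pos_of_pos (ha t) θ)
  calc p t * G t * a t ^ θ ≤ p t * G t * (κ * G t) :=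
        mul_le_mul_of_nonneg_left ht (mul_nonneg (h.p_nonneg t) (h.G_nonneg t))
    _ = κ / c * (c * (p t * G t ^ 2)) := by field_simp
    _ ≤ κ / c * (a t - a (t + 1)) := by gcongr; exact h.decrease_le ℓ t
    _ = κ / (c * (1 - θ)) * ((1 - θ) * (a t - a (t + 1))) := by field_simp
    _ ≤ κ / (c * (1 - θ)) * (a t ^ θ * (a t ^ (1 - θ) - a (t + 1) ^ (1 - θ))) := by
        refine mul_le_mul_of_nonneg_left ?_ (by positivity)
        exact one_sub_mul_sub_le_rpow_mul_sub (ha t).le (ha (t + 1)).le hθ hθ₁.le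
    _ = _ := by ring

theorem summable_mul (h : IsApproxDescent c D p G φ) (hφ : Tendsto φ atTop (𝓝 ℓ))
    (hθ : 1 / 2 ≤ θ) (hθ₁ : θ < 1) (hloj : ∀ᶠ t in atTop, |φ t - ℓ| ^ θ ≤ κ * G t) :
    Summable fun t => p t * G t := by
  have hc := h.c_pos
  have h1θ : 0 < 1 - θ := sub_pos.2 hθ₁
  have h_pos := h.excess_pos hφ
  set u : ℕ → ℝ := fun t => excess D φ ℓ t ^ (1 - θ)
  have hu : Antitone u := fun s t hst =>
    Real.rpow_le_rpow (h_pos t).le (h.antitone_excess ℓ hst) h1θ.le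
  set K := (|κ| + 1) / (c * (1 - θ))
  have h_bound : ∀ᶠ t in atTop, ‖p t * G t‖ ≤ K * (u t - u (t + 1)) + √D * (1 / 2) ^ t := by
    filter_upwards [h.eventually_excess_rpow_le hφ hθ hθ₁.le hloj] with t ht
    rw [sqrt_div_four_pow] at ht
    rw [Real.norm_of_nonneg (mul_nonneg (h.p_nonneg t) (h.G_nonneg t))]
    have h_drop : 0 ≤ K * (u t - u (t + 1)) :=
      mul_nonneg (by positivity) (sub_nonneg.2 (hu t.le_succ))
    rcases le_total (√D * (1 / 2) ^ t) (G t) with hG | hG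
    · have h_loj : excess D φ ℓ t ^ θ ≤ (|κ| + 1) * G t := by
        nlinarith [mul_le_mul_of_nonneg_right (le_abs_self κ) (h.G_nonneg t)]
      have h_error : 0 ≤ √D * (1 / 2) ^ t := by positivity
      linarith [h.mul_le_of_excess_rpow_le hφ (by linarith) hθ₁ (by positivity) h_loj]
    · linarith [mul_le_of_le_one_left (h.G_nonneg t) (h.p_le_one t)]
  have h_sub := summable_sub_succ hu
    ⟨0, Set.forall_mem_range.2 fun t => Real.rpow_nonneg (h_pos t).le _⟩
  exact ((h_sub.mul_left K).add (summable_geometric_two.mul_left _)).of_norm_bounded_eventually_nat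
    h_bound

theorem eventually_excess_succ_le (h : IsApproxDescent c D p G φ) (hφ : Tendsto φ atTop (𝓝 ℓ))
    (hθ : 1 / 2 ≤ θ) (hθ₁ : θ ≤ 1) (hloj : ∀ᶠ t in atTop, |φ t - ℓ| ^ θ ≤ κ * G t) :
    ∀ᶠ t in atTop, excess D φ ℓ (t + 1) ≤
      excess D φ ℓ t - contraction c κ * p t * excess D φ ℓ t ^ (2 * θ) := by
  have hc := h.c_pos
  filter_upwards [h.eventually_excess_rpow_le hφ hθ hθ₁ hloj] with t ht
  set a := excess D φ ℓ
  have ha : 0 < a t := h.excess_pos hφ t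
  have hD : 0 ≤ D / 4 ^ t := div_nonneg h.D_pos.le (by positivity)
  have h_sq : a t ^ (2 * θ) ≤ 2 * κ ^ 2 * G t ^ 2 + 2 * (D / 4 ^ t) := by
    rw [mul_comm, Real.rpow_mul ha.le, Real.rpow_two]
    nlinarith [pow_le_pow_left₀ (Real.rpow_nonneg ha.le θ) ht 2,
      sq_nonneg (κ * G t - √(D / 4 ^ t)), Real.sq_sqrt hD]
  have h_le : p t * a t ^ (2 * θ) ≤ (2 * κ ^ 2 / c + 8) * (a t - a (t + 1)) := by
    have h_drop := h.excess_succ_add_le ℓ t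
    rw [div_right_comm] at h_drop
    calc p t * a t ^ (2 * θ) ≤ p t * (2 * κ ^ 2 * G t ^ 2 + 2 * (D / 4 ^ t)) :=
          mul_le_mul_of_nonneg_left h_sq (h.p_nonneg t)
      _ = 2 * κ ^ 2 / c * (c * (p t * G t ^ 2)) + p t * (2 * (D / 4 ^ t)) := by field_simp
      _ ≤ 2 * κ ^ 2 / c * (a t - a (t + 1)) + 8 * (a t - a (t + 1)) := by
          refine add_le_add (mul_le_mul_of_nonneg_left (h.decrease_le ℓ t) (by positivity)) ?_
          linarith [mul_le_of_le_one_left (mul_nonneg zero_le_two hD) (h.p_le_one t),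
            h.decrease_nonneg t]
      _ = _ := by ring
  have : contraction c κ * p t * a t ^ (2 * θ) ≤ a t - a (t + 1) := by
    rwa [contraction, mul_assoc, one_div, inv_mul_le_iff₀ (by positivity)]
  linarith

theorem tendsto_pow_mul_sub (h : IsApproxDescent c D p G φ) (hφ : Tendsto φ atTop (𝓝 ℓ))
    (hloj : ∀ᶠ t in atTop, |φ t - ℓ| ^ (1 / 2 : ℝ) ≤ κ * G t) {Q : ℝ} (hQ : 0 ≤ Q)
    (hprod : Tendsto (fun t : ℕ => Q ^ t * ∏ s ∈ Finset.range t, (1 - contraction c κ * p s))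
      atTop (𝓝 0)) :
    Tendsto (fun t : ℕ => Q ^ t * (φ t - ℓ)) atTop (𝓝 0) := by
  obtain ⟨B, hB⟩ := exists_eventually_le_mul_prod (h.one_sub_contraction_mul_pos κ) <| by
    simpa using h.eventually_excess_succ_le hφ le_rfl (by norm_num) hloj
  refine squeeze_zero_norm' ?_ (by simpa using hprod.const_mul (3 * B))
  filter_upwards [hB] with t ht
  rw [norm_mul, Real.norm_of_nonneg (pow_nonneg hQ t), Real.norm_eq_abs]
  calc Q ^ t * |φ t - ℓ|
      ≤ Q ^ t * (3 * (B * ∏ s ∈ Finset.range t, (1 - contraction c κ * p s))) := by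
        gcongr
        exact (h.abs_sub_le_three_mul_excess hφ t).trans (by gcongr)
    _ = _ := by ring

theorem isBigO_sub (h : IsApproxDescent c D p G φ) (hφ : Tendsto φ atTop (𝓝 ℓ))
    (hθ : 1 / 2 < θ) (hθ₁ : θ ≤ 1) (hloj : ∀ᶠ t in atTop, |φ t - ℓ| ^ θ ≤ κ * G t)
    (hp : HasPosLowerDensity p) :
    (fun t => φ t - ℓ) =O[atTop] fun t : ℕ => (t : ℝ) ^ (1 / (1 - 2 * θ)) := by
  have h_excess := hp.isBigO_rpow (h.excess_pos hφ) (β := 2 * θ - 1) (by linarith)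
    (contraction_pos h.c_pos κ) <| by
      simpa using h.eventually_excess_succ_le hφ hθ.le hθ₁ hloj
  rw [← one_div_neg_eq_neg_one_div, neg_sub] at h_excess
  exact (IsBigO.of_bound 3 <| .of_forall fun t => by
    simpa [abs_of_pos (h.excess_pos hφ t)] using h.abs_sub_le_three_mul_excess hφ t).trans h_excess

end IsApproxDescent

/-! ### Smooth functions and projected gradient steps -/

section Smooth

open scoped NNReal

variable {F ι : Type*} [NormedAddCommGroup F] [InnerProductSpace ℝ F] [Fintype ι]

/-- The squared norm of the orthogonal projection of `u` onto the span of the frame `v`, for an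
orthonormal `v`. -/
noncomputable def frameSq (v : ι → F) (u : F) : ℝ := ∑ i, inner ℝ u (v i) ^ 2

theorem frameSq_nonneg (v : ι → F) (u : F) : 0 ≤ frameSq v u :=
  Finset.sum_nonneg fun _ _ => sq_nonneg _

theorem frameSq_le_norm_sq {v : ι → F} (hv : Orthonormal ℝ v) (u : F) : frameSq v u ≤ ‖u‖ ^ 2 := by
  simpa [frameSq, real_inner_comm] using hv.sum_inner_products_le (s := Finset.univ) u

theorem frameSq_smul (v : ι → F) (a : ℝ) (u : F) : frameSq v (a • u) = a ^ 2 * frameSq v u := by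
  simp [frameSq, inner_smul_left, mul_pow, Finset.mul_sum]

theorem frameSq_map (U : F ≃ₗᵢ[ℝ] F) (v : ι → F) (u : F) :
    frameSq (fun i => U (v i)) (U u) = frameSq v u := by
  simp [frameSq]

theorem norm_sum_smul_sq {v : ι → F} (hv : Orthonormal ℝ v) (d : ι → ℝ) :
    ‖∑ i, d i • v i‖ ^ 2 = ∑ i, d i ^ 2 := by
  rw [← real_inner_self_eq_norm_sq, hv.inner_sum]
  simp [sq]

theorem norm_sum_smul_le {v : ι → F} (hv : ∀ i, ‖v i‖ = 1) {d : ι → ℝ} {g : F} {ε : ℝ}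
    (hd : ∀ i, |d i - inner ℝ g (v i)| ≤ ε) :
    ‖∑ i, d i • v i‖ ≤ Fintype.card ι * (‖g‖ + ε) := by
  have h_term (i : ι) : ‖d i • v i‖ ≤ ‖g‖ + ε := by
    have h_inner := norm_inner_le_norm (𝕜 := ℝ) g (v i)
    rw [hv i, mul_one] at h_inner
    rw [norm_smul, hv i, mul_one]
    exact (norm_le_norm_add_norm_sub' (d i) (inner ℝ g (v i))).trans (add_le_add h_inner (hd i))
  simpa [mul_add] using norm_sum_le_of_le Finset.univ fun i _ => h_term i

/-- The central difference quotient of `f` at `x` in direction `v` with granularity `δ`. -/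
noncomputable def centralDiff (f : F → ℝ) (δ : ℝ) (x v : F) : ℝ :=
  (f (x + δ • v) - f (x - δ • v)) / (2 * δ)

theorem neg_mul_add_sq_le {K h c d γ ε : ℝ} (hK : 0 ≤ K) (hc : 0 < c)
    (hc_eq : c = h - K * h ^ 2 / 2) (hd : |d - γ| ≤ ε) :
    -(h * (d * γ)) + K / 2 * (h ^ 2 * d ^ 2) ≤
      -(c / 2 * γ ^ 2) + (h ^ 2 / (2 * c) + K * h ^ 2 / 2) * ε ^ 2 := by
  obtain ⟨e, rfl⟩ : ∃ e, d = γ + e := ⟨d - γ, by ring⟩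
  rw [add_sub_cancel_left] at hd
  have h_coeff : (K * h ^ 2 - h) ^ 2 ≤ h ^ 2 := by
    have : 0 ≤ K * h ^ 2 := by positivity
    exact sq_le_sq' (by linarith) (by linarith)
  have h_young : (K * h ^ 2 - h) * (γ * e) ≤
      c / 2 * γ ^ 2 + (K * h ^ 2 - h) ^ 2 / (2 * c) * e ^ 2 := by
    have h_sq : 0 ≤ (c * γ - (K * h ^ 2 - h) * e) ^ 2 / (2 * c) := by positivity
    have h_expand : (c * γ - (K * h ^ 2 - h) * e) ^ 2 / (2 * c) = c / 2 * γ ^ 2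
        - (K * h ^ 2 - h) * (γ * e) + (K * h ^ 2 - h) ^ 2 / (2 * c) * e ^ 2 := by
      field_simp
      ring
    linarith
  calc -(h * ((γ + e) * γ)) + K / 2 * (h ^ 2 * (γ + e) ^ 2)
      = -(c * γ ^ 2) + (K * h ^ 2 - h) * (γ * e) + K * h ^ 2 / 2 * e ^ 2 := by rw [hc_eq]; ring
    _ ≤ -(c / 2 * γ ^ 2) + (h ^ 2 / (2 * c) + K * h ^ 2 / 2) * e ^ 2 := by
        have : (K * h ^ 2 - h) ^ 2 / (2 * c) * e ^ 2 ≤ h ^ 2 / (2 * c) * e ^ 2 := by gcongr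
        linarith
    _ ≤ -(c / 2 * γ ^ 2) + (h ^ 2 / (2 * c) + K * h ^ 2 / 2) * ε ^ 2 := by
        have : e ^ 2 ≤ ε ^ 2 := sq_le_sq.2 (hd.trans (le_abs_self ε))
        gcongr

variable [CompleteSpace F] {f : F → ℝ} {K : ℝ≥0}

theorem continuous_gradient_of_contDiff (hf : ContDiff ℝ 1 f) : Continuous (gradient f) :=
  (InnerProductSpace.toDual ℝ F).symm.continuous.comp (hf.continuous_fderiv one_ne_zero)

theorem hasDerivAt_comp_add_smul (hf : Differentiable ℝ f) (x h : F) (s : ℝ) :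
    HasDerivAt (fun s : ℝ => f (x + s • h)) (inner ℝ (gradient f (x + s • h)) h) s := by
  have h_line : HasDerivAt (fun s : ℝ => x + s • h) h s := by
    simpa using ((hasDerivAt_id s).smul_const h).const_add x
  simpa using! (hf (x + s • h)).hasGradientAt.hasFDerivAt.comp_hasDerivAt s h_line

theorem abs_sub_sub_inner_gradient_le (hf : Differentiable ℝ f)
    (hgrad : LipschitzWith K (gradient f)) (x h : F) :
    |f (x + h) - f x - inner ℝ (gradient f x) h| ≤ K / 2 * ‖h‖ ^ 2 := by
  set φ : ℝ → ℝ := fun s => f (x + s • h) - f x - s * inner ℝ (gradient f x) h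
  have hφ (s : ℝ) : HasDerivAt φ (inner ℝ (gradient f (x + s • h) - gradient f x) h) s := by
    rw [inner_sub_left]
    simpa [φ] using! ((hasDerivAt_comp_add_smul hf x h s).sub_const (f x)).sub
      ((hasDerivAt_id s).mul_const (inner ℝ (gradient f x) h))
  have h_bound (s : ℝ) :
      HasDerivAt (fun s : ℝ => K / 2 * ‖h‖ ^ 2 * s ^ 2) (K * ‖h‖ ^ 2 * s) s := by
    convert! (hasDerivAt_pow 2 s).const_mul (K / 2 * ‖h‖ ^ 2) using 1
    simp
    ring
  have h_deriv (s : ℝ) (hs : s ∈ Set.Ico (0 : ℝ) 1) :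
      ‖inner ℝ (gradient f (x + s • h) - gradient f x) h‖ ≤ K * ‖h‖ ^ 2 * s := by
    have h_lip := hgrad.norm_sub_le (x + s • h) x
    rw [add_sub_cancel_left, norm_smul, Real.norm_of_nonneg hs.1] at h_lip
    calc _ ≤ ‖gradient f (x + s • h) - gradient f x‖ * ‖h‖ := norm_inner_le_norm _ _
      _ ≤ K * (s * ‖h‖) * ‖h‖ := by gcongr
      _ = K * ‖h‖ ^ 2 * s := by ring
  simpa [φ] using image_norm_le_of_norm_deriv_right_le_deriv_boundary
    (fun s _ => (hφ s).continuousAt.continuousWithinAt) (fun s _ => (hφ s).hasDerivWithinAt)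
    (by simp [φ]) h_bound h_deriv (Set.right_mem_Icc.2 zero_le_one)

theorem abs_centralDiff_sub_inner_gradient_le (hf : Differentiable ℝ f)
    (hgrad : LipschitzWith K (gradient f)) {δ : ℝ} (hδ : 0 < δ) (x v : F) :
    |centralDiff f δ x v - inner ℝ (gradient f x) v| ≤ K * δ / 2 * ‖v‖ ^ 2 := by
  have h_forward := abs_sub_sub_inner_gradient_le hf hgrad x (δ • v)
  have h_backward := abs_sub_sub_inner_gradient_le hf hgrad x (-(δ • v))
  rw [norm_neg, ← sub_eq_add_neg] at h_backward
  simp only [norm_smul, inner_smul_right, inner_neg_right, Real.norm_of_nonneg hδ.le]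
    at h_forward h_backward
  rw [abs_le] at h_forward h_backward
  have h_eq : centralDiff f δ x v - inner ℝ (gradient f x) v
      = (f (x + δ • v) - f (x - δ • v) - 2 * δ * inner ℝ (gradient f x) v) / (2 * δ) := by
    rw [centralDiff]
    field_simp
  rw [h_eq, abs_le, le_div_iff₀ (by positivity), div_le_iff₀ (by positivity)]
  constructor <;> nlinarith

theorem map_sub_smul_sum_le (hf : Differentiable ℝ f) (hgrad : LipschitzWith K (gradient f))
    {h c ε : ℝ} (hc : 0 < c) (hc_eq : c = h - K * h ^ 2 / 2)
    {v : ι → F} (hv : Orthonormal ℝ v) {d : ι → ℝ} {x : F}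
    (hd : ∀ i, |d i - inner ℝ (gradient f x) (v i)| ≤ ε) :
    f (x - h • ∑ i, d i • v i) ≤ f x - c / 2 * frameSq v (gradient f x) +
      Fintype.card ι * ((h ^ 2 / (2 * c) + K * h ^ 2 / 2) * ε ^ 2) := by
  have h_taylor := (abs_le.1 (abs_sub_sub_inner_gradient_le hf hgrad x (-(h • ∑ i, d i • v i)))).2
  rw [norm_neg, norm_smul, mul_pow, norm_sum_smul_sq hv, Real.norm_eq_abs, sq_abs, inner_neg_right,
    inner_smul_right, inner_sum, ← sub_eq_add_neg] at h_taylor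
  simp only [inner_smul_right] at h_taylor
  have h_sum := Finset.sum_le_sum fun i (_ : i ∈ Finset.univ) =>
    neg_mul_add_sq_le K.2 hc hc_eq (hd i)
  simp only [Finset.sum_add_distrib, Finset.sum_neg_distrib, ← Finset.mul_sum, Finset.sum_const,
    Finset.card_univ, nsmul_eq_mul, NNReal.val_eq_coe] at h_sum
  rw [frameSq]
  linarith

end Smooth

/-! ### Adapted sequences with conditional means bounded below -/

section CondMean

variable {Ω α β : Type*} {m : MeasurableSpace Ω} {P : Measure Ω}

/-- `w` is a sequence of random numbers in `[0, 1]`, where `w t` is observed at time `t + 1` and has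
conditional mean at least `q` given the past `𝓕 t`. The latter is expressed by integrating against
nonnegative `𝓕 t`-measurable functions. -/
structure HasCondMeanGE (P : Measure Ω) (𝓕 : Filtration ℕ m) (q : ℝ) (w : ℕ → Ω → ℝ) : Prop where
  measurable_succ : ∀ t, Measurable[𝓕 (t + 1)] (w t)
  nonneg : ∀ᵐ ω ∂P, ∀ t, 0 ≤ w t ω
  le_one : ∀ᵐ ω ∂P, ∀ t, w t ω ≤ 1
  mul_lintegral_le : ∀ t (Z : Ω → ENNReal), Measurable[𝓕 t] Z →
    ENNReal.ofReal q * ∫⁻ ω, Z ω ∂P ≤ ∫⁻ ω, Z ω * ENNReal.ofReal (w t ω) ∂P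

theorem ae_tendsto_pow_mul_of_lintegral_le {X : ℕ → Ω → ℝ} (hX : ∀ t, Measurable (X t))
    (hX₀ : ∀ᵐ ω ∂P, ∀ t, 0 ≤ X t ω) {C : ENNReal} (hC : C ≠ ⊤)
    (hXC : ∀ t, ∫⁻ ω, ENNReal.ofReal (X t ω) ∂P ≤ C) {ρ : ℝ} (hρ₀ : 0 ≤ ρ) (hρ₁ : ρ < 1) :
    ∀ᵐ ω ∂P, Tendsto (fun t => ρ ^ t * X t ω) atTop (𝓝 0) := by
  have h_meas (t : ℕ) : Measurable fun ω => ENNReal.ofReal (ρ ^ t * X t ω) :=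
    ((hX t).const_mul _).ennreal_ofReal
  have h_tsum : ∫⁻ ω, ∑' t, ENNReal.ofReal (ρ ^ t * X t ω) ∂P ≠ ⊤ := by
    rw [lintegral_tsum fun t => (h_meas t).aemeasurable]
    refine ne_top_of_le_ne_top (ENNReal.mul_ne_top
      (summable_geometric_of_lt_one hρ₀ hρ₁).tsum_ofReal_ne_top hC) ?_
    rw [← ENNReal.tsum_mul_right]
    refine ENNReal.tsum_le_tsum fun t => ?_
    simp_rw [ENNReal.ofReal_mul (pow_nonneg hρ₀ t)]
    rw [lintegral_const_mul _ (hX t).ennreal_ofReal]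
    gcongr
    exact hXC t
  filter_upwards [ae_lt_top (Measurable.tsum h_meas) h_tsum, hX₀] with ω h_fin hω
  refine ((ENNReal.tendsto_toReal ENNReal.zero_ne_top).comp
    (ENNReal.tendsto_atTop_zero_of_tsum_ne_top h_fin.ne)).congr fun t => ?_
  exact ENNReal.toReal_ofReal (mul_nonneg (pow_nonneg hρ₀ t) (hω t))

theorem sum_ite_sum_range_le_le {x : ℕ → ENNReal} {M C : ENNReal} (hx : ∀ t, x t ≤ C) (t : ℕ) :
    ∑ s ∈ Finset.range t, (if ∑ i ∈ Finset.range s, x i ≤ M then x s else 0) ≤ M + C := by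
  induction t with
  | zero => simp
  | succ t ih =>
    rw [Finset.sum_range_succ]
    split_ifs with h_sum
    · refine add_le_add (le_trans (Finset.sum_le_sum fun s _ => ?_) h_sum) (hx t)
      split_ifs <;> simp
    · simpa using ih

namespace HasCondMeanGE

variable {𝓕 : Filtration ℕ m} {q : ℝ} {w : ℕ → Ω → ℝ}

theorem measurable (hw : HasCondMeanGE P 𝓕 q w) (t : ℕ) : Measurable (w t) :=
  (hw.measurable_succ t).mono (𝓕.le _) le_rfl

theorem ae_tsum_lt_top_of_tsum_mul_le [IsFiniteMeasure P] (hw : HasCondMeanGE P 𝓕 q w)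
    (hq : 0 < q) {Y : ℕ → Ω → ENNReal} (hY : ∀ t, Measurable[𝓕 t] (Y t)) {C : ENNReal}
    (hC : C ≠ ⊤) (hYC : ∀ᵐ ω ∂P, ∑' t, Y t ω * ENNReal.ofReal (w t ω) ≤ C) :
    ∀ᵐ ω ∂P, ∑' t, Y t ω < ⊤ := by
  have hY' (t : ℕ) : Measurable (Y t) := (hY t).mono (𝓕.le t) le_rfl
  have h_le : ENNReal.ofReal q * ∫⁻ ω, ∑' t, Y t ω ∂P ≤ C * P Set.univ := by
    calc ENNReal.ofReal q * ∫⁻ ω, ∑' t, Y t ω ∂P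
        = ∑' t, ENNReal.ofReal q * ∫⁻ ω, Y t ω ∂P := by
          rw [lintegral_tsum fun t => (hY' t).aemeasurable, ENNReal.tsum_mul_left]
      _ ≤ ∑' t, ∫⁻ ω, Y t ω * ENNReal.ofReal (w t ω) ∂P :=
          ENNReal.tsum_le_tsum fun t => hw.mul_lintegral_le t _ (hY t)
      _ = ∫⁻ ω, ∑' t, Y t ω * ENNReal.ofReal (w t ω) ∂P :=
          (lintegral_tsum fun t =>
            ((hY' t).mul (hw.measurable t).ennreal_ofReal).aemeasurable).symm
      _ ≤ ∫⁻ _, C ∂P := lintegral_mono_ae hYC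
      _ = C * P Set.univ := lintegral_const C
  refine ae_lt_top (Measurable.tsum hY') fun h_top => ?_
  rw [h_top, ENNReal.mul_top (by simpa using hq), top_le_iff] at h_le
  exact ENNReal.mul_ne_top hC (measure_ne_top P _) h_le

theorem ae_tsum_ne_top_of_le_one [IsFiniteMeasure P] (hw : HasCondMeanGE P 𝓕 q w)
    (hq : 0 < q) {Y : ℕ → Ω → ENNReal} (hY : ∀ t, Measurable[𝓕 t] (Y t))
    (hY₁ : ∀ t ω, Y t ω ≤ 1) :
    ∀ᵐ ω ∂P, ∑' t, Y t ω * ENNReal.ofReal (w t ω) ≠ ⊤ → ∑' t, Y t ω ≠ ⊤ := by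
  set x : ℕ → Ω → ENNReal := fun t ω => Y t ω * ENNReal.ofReal (w t ω)
  have hx (t : ℕ) : Measurable[𝓕 (t + 1)] (x t) :=
    ((hY t).mono (𝓕.mono t.le_succ) le_rfl).mul (hw.measurable_succ t).ennreal_ofReal
  -- Stopping `Y` once the observed sum exceeds `M` keeps it adapted and makes the sum bounded.
  let Z : ℕ → ℕ → Ω → ENNReal := fun M t ω =>
    if ∑ i ∈ Finset.range t, x i ω ≤ M then Y t ω else 0
  have hZ (M t : ℕ) : Measurable[𝓕 t] (Z M t) := by
    have h_sum : Measurable[𝓕 t] fun ω => ∑ i ∈ Finset.range t, x i ω :=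
      Finset.measurable_fun_sum _ fun i hi =>
        (hx i).mono (𝓕.mono (Finset.mem_range.1 hi)) le_rfl
    exact Measurable.ite (h_sum measurableSet_Iic) (hY t) measurable_const
  have hZ_le (M : ℕ) : ∀ᵐ ω ∂P, ∑' t, Z M t ω * ENNReal.ofReal (w t ω) ≤ M + 1 := by
    filter_upwards [hw.le_one] with ω hω
    have hx₁ (t : ℕ) : x t ω ≤ 1 :=
      mul_le_one' (hY₁ t ω) (ENNReal.ofReal_le_one.2 (hω t))
    refine ENNReal.tsum_le_of_sum_range_le fun t => ?_
    simpa only [Z, x, ite_mul, zero_mul] using sum_ite_sum_range_le_le (M := M) hx₁ t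
  have hZ_fin (M : ℕ) : ∀ᵐ ω ∂P, ∑' t, Z M t ω < ⊤ :=
    hw.ae_tsum_lt_top_of_tsum_mul_le hq (hZ M) (by finiteness) (hZ_le M)
  filter_upwards [ae_all_iff.2 hZ_fin] with ω hω h_sum
  obtain ⟨M, hM⟩ := ENNReal.exists_nat_gt h_sum
  have h_eq (t : ℕ) : Z M t ω = Y t ω :=
    if_pos ((ENNReal.sum_le_tsum (f := fun i => x i ω) _).trans hM.le)
  simpa only [h_eq] using (hω M).ne

theorem ae_summable_of_summable_mul [IsFiniteMeasure P] (hw : HasCondMeanGE P 𝓕 q w)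
    (hq : 0 < q) {Y : ℕ → Ω → ℝ} (hY : ∀ t, Measurable[𝓕 t] (Y t)) (hY₀ : ∀ t ω, 0 ≤ Y t ω) :
    ∀ᵐ ω ∂P, Summable (fun t => w t ω * Y t ω) → Summable fun t => Y t ω := by
  have h_trunc := hw.ae_tsum_ne_top_of_le_one hq
    (fun t => ((hY t).min measurable_const).ennreal_ofReal (f := fun ω => min (Y t ω) 1))
    fun t ω => ENNReal.ofReal_le_one.2 (min_le_right _ _)
  filter_upwards [h_trunc, hw.nonneg] with ω hω hw₀ h_sum
  have h_min₀ (t : ℕ) : 0 ≤ min (Y t ω) 1 := le_min (hY₀ t ω) zero_le_one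
  have h_min : Summable fun t => min (Y t ω) 1 := by
    refine (ENNReal.summable_toReal (hω ?_)).congr fun t => ENNReal.toReal_ofReal (h_min₀ t)
    simp_rw [← ENNReal.ofReal_mul (h_min₀ _), mul_comm _ (w _ ω)]
    exact (h_sum.of_nonneg_of_le (fun t => mul_nonneg (hw₀ t) (h_min₀ t)) fun t =>
      mul_le_mul_of_nonneg_left (min_le_left _ _) (hw₀ t)).tsum_ofReal_ne_top
  refine h_min.congr_atTop ?_
  filter_upwards [h_min.tendsto_atTop_zero.eventually_lt_const one_pos] with t ht
  exact min_eq_left ((min_lt_iff.1 ht).resolve_right (lt_irrefl 1)).le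

theorem ae_prod_nonneg (hw : HasCondMeanGE P 𝓕 q w) {r : ℝ} (hr : r ≤ 1) :
    ∀ᵐ ω ∂P, ∀ t, 0 ≤ ∏ s ∈ Finset.range t, (1 - r * w s ω) := by
  filter_upwards [hw.nonneg, hw.le_one] with ω h₀ h₁ t
  exact Finset.prod_nonneg fun s _ => by nlinarith [h₀ s, h₁ s]

theorem measurable_prod (hw : HasCondMeanGE P 𝓕 q w) (r : ℝ) (t : ℕ) :
    Measurable[𝓕 t] fun ω => ∏ s ∈ Finset.range t, (1 - r * w s ω) :=
  Finset.measurable_fun_prod _ fun s hs =>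
    (((hw.measurable_succ s).mono (𝓕.mono (Finset.mem_range.1 hs)) le_rfl).const_mul
      r).const_sub 1

theorem one_add_mul_lintegral_prod_succ_le (hw : HasCondMeanGE P 𝓕 q w) (hq : 0 ≤ q) {r : ℝ}
    (hr₀ : 0 ≤ r) (hr₁ : r ≤ 1) (t : ℕ) :
    ENNReal.ofReal (1 + r * q)
        * ∫⁻ ω, ENNReal.ofReal (∏ s ∈ Finset.range (t + 1), (1 - r * w s ω)) ∂P ≤
      ∫⁻ ω, ENNReal.ofReal (∏ s ∈ Finset.range t, (1 - r * w s ω)) ∂P := by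
  set W : ℕ → Ω → ℝ := fun t ω => ∏ s ∈ Finset.range t, (1 - r * w s ω)
  have hW (t : ℕ) : Measurable (W t) := (hw.measurable_prod r t).mono (𝓕.le t) le_rfl
  have hWw : Measurable fun ω => ENNReal.ofReal (W t ω) * ENNReal.ofReal (w t ω) :=
    (hW t).ennreal_ofReal.mul (hw.measurable t).ennreal_ofReal
  have h_step : ∫⁻ ω, ENNReal.ofReal (W (t + 1) ω) ∂P
      + ENNReal.ofReal (r * q) * ∫⁻ ω, ENNReal.ofReal (W t ω) ∂P
      ≤ ∫⁻ ω, ENNReal.ofReal (W t ω) ∂P := by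
    calc _ ≤ ∫⁻ ω, ENNReal.ofReal (W (t + 1) ω) ∂P
          + ENNReal.ofReal r * ∫⁻ ω, ENNReal.ofReal (W t ω) * ENNReal.ofReal (w t ω) ∂P := by
          rw [ENNReal.ofReal_mul hr₀, mul_assoc]
          gcongr
          exact hw.mul_lintegral_le t _ (hw.measurable_prod r t).ennreal_ofReal
      _ = ∫⁻ ω, ENNReal.ofReal (W (t + 1) ω)
          + ENNReal.ofReal r * (ENNReal.ofReal (W t ω) * ENNReal.ofReal (w t ω)) ∂P := by
          rw [lintegral_add_left (hW (t + 1)).ennreal_ofReal, lintegral_const_mul _ hWw]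
      _ = ∫⁻ ω, ENNReal.ofReal (W t ω) ∂P := by
          refine lintegral_congr_ae ?_
          filter_upwards [hw.ae_prod_nonneg hr₁, hw.nonneg] with ω hW₀ hw₀
          rw [← ENNReal.ofReal_mul (hW₀ t), ← ENNReal.ofReal_mul hr₀, ← ENNReal.ofReal_add
            (hW₀ (t + 1)) (mul_nonneg hr₀ (mul_nonneg (hW₀ t) (hw₀ t)))]
          simp only [W, Finset.prod_range_succ]
          ring_nf
  rw [ENNReal.ofReal_add zero_le_one (mul_nonneg hr₀ hq), ENNReal.ofReal_one, add_mul, one_mul]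
  exact (add_le_add_right (mul_le_mul_right (le_self_add.trans h_step) _) _).trans h_step

theorem lintegral_pow_mul_prod_le (hw : HasCondMeanGE P 𝓕 q w) (hq : 0 ≤ q) {r : ℝ}
    (hr₀ : 0 ≤ r) (hr₁ : r ≤ 1) (t : ℕ) :
    ∫⁻ ω, ENNReal.ofReal ((1 + r * q) ^ t * ∏ s ∈ Finset.range t, (1 - r * w s ω)) ∂P ≤
      P Set.univ := by
  have hrq : 0 ≤ 1 + r * q := by positivity
  have h_meas (t : ℕ) :
      Measurable fun ω => ENNReal.ofReal (∏ s ∈ Finset.range t, (1 - r * w s ω)) :=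
    ((hw.measurable_prod r t).mono (𝓕.le t) le_rfl).ennreal_ofReal
  simp_rw [ENNReal.ofReal_mul (pow_nonneg hrq _)]
  rw [lintegral_const_mul _ (h_meas t)]
  induction t with
  | zero => simp
  | succ t ih =>
    rw [pow_succ, ENNReal.ofReal_mul (pow_nonneg hrq t), mul_assoc]
    exact (mul_le_mul_right (hw.one_add_mul_lintegral_prod_succ_le hq hr₀ hr₁ t) _).trans ih

theorem exists_ae_tendsto_pow_mul_prod [IsFiniteMeasure P] (hw : HasCondMeanGE P 𝓕 q w)
    (hq : 0 < q) {r : ℝ} (hr₀ : 0 < r) (hr₁ : r ≤ 1) :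
    ∃ Q > 1, ∀ᵐ ω ∂P,
      Tendsto (fun t : ℕ => Q ^ t * ∏ s ∈ Finset.range t, (1 - r * w s ω)) atTop (𝓝 0) := by
  have hrq : 0 < r * q := mul_pos hr₀ hq
  refine ⟨1 + r * q / 2, by linarith, ?_⟩
  have h_ae := ae_tendsto_pow_mul_of_lintegral_le
    (X := fun t ω => (1 + r * q) ^ t * ∏ s ∈ Finset.range t, (1 - r * w s ω))
    (fun t => ((hw.measurable_prod r t).mono (𝓕.le t) le_rfl).const_mul _)
    (by
      filter_upwards [hw.ae_prod_nonneg hr₁] with ω hω t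
      exact mul_nonneg (by positivity) (hω t))
    (measure_ne_top P _) (hw.lintegral_pow_mul_prod_le hq.le hr₀.le hr₁)
    (ρ := (1 + r * q / 2) / (1 + r * q)) (by positivity)
    ((div_lt_one (by positivity)).2 (by linarith))
  filter_upwards [h_ae] with ω hω
  refine hω.congr fun t => ?_
  rw [div_pow, ← mul_assoc, div_mul_cancel₀ _ (by positivity)]

theorem ae_hasPosLowerDensity [IsFiniteMeasure P] (hw : HasCondMeanGE P 𝓕 q w) (hq : 0 < q) :
    ∀ᵐ ω ∂P, HasPosLowerDensity fun t => w t ω := by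
  obtain ⟨Q, hQ, hprod⟩ := hw.exists_ae_tendsto_pow_mul_prod hq (r := 1 / 2) (by norm_num)
    (by norm_num)
  filter_upwards [hprod, hw.nonneg, hw.le_one] with ω hω h₀ h₁
  exact hasPosLowerDensity_of_tendsto_pow_mul_prod h₀ h₁ (by norm_num) (by norm_num) hQ hω

end HasCondMeanGE

variable {_ : MeasurableSpace α} {_ : MeasurableSpace β}

theorem lintegral_comp_prodMk_of_indepFun [IsFiniteMeasure P] {X : Ω → α} {Y : Ω → β}
    (hX : Measurable X) (hY : Measurable Y) (hXY : IndepFun X Y P) {F : α × β → ENNReal}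
    (hF : Measurable F) :
    ∫⁻ ω, F (X ω, Y ω) ∂P = ∫⁻ ω, ∫⁻ y, F (X ω, y) ∂(P.map Y) ∂P := by
  rw [← lintegral_map hF (hX.prodMk hY),
    hXY.map_prod_eq_prod_map_map hX.aemeasurable hY.aemeasurable,
    lintegral_prod _ hF.aemeasurable, lintegral_map hF.lintegral_prod_right' hX]

/-- The filtration of the strict past of a sequence `V`: at time `t` only `V 0, …, V (t - 1)` have
been observed, unlike in `Filtration.natural`. -/
def pastFiltration {V : ℕ → Ω → β} (hV : ∀ t, Measurable (V t)) : Filtration ℕ m where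
  seq t := ⨆ i ∈ Set.Iio t, MeasurableSpace.comap (V i) inferInstance
  mono' _ _ hst := biSup_mono fun _ hi => lt_of_lt_of_le hi hst
  le' _ := iSup₂_le fun i _ => (hV i).comap_le

theorem measurable_pastFiltration_succ {V : ℕ → Ω → β} (hV : ∀ t, Measurable (V t)) (t : ℕ) :
    Measurable[pastFiltration hV (t + 1)] (V t) :=
  measurable_iff_comap_le.2 <| le_iSup₂_of_le (f := fun i (_ : i ∈ Set.Iio (t + 1)) =>
    MeasurableSpace.comap (V i) inferInstance) t (Nat.lt_succ_self t) le_rfl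

theorem indepFun_of_measurable_pastFiltration {V : ℕ → Ω → β} (hV : ∀ t, Measurable (V t))
    (h_indep : iIndepFun V P) {t : ℕ} {X : Ω → α} (hX : Measurable[pastFiltration hV t] X) :
    IndepFun X (V t) P := by
  have h_past := indep_iSup_of_disjoint (fun i => (hV i).comap_le) h_indep
    (S := Set.Iio t) (T := {t}) (by simp)
  rw [iSup_singleton] at h_past
  exact indep_of_indep_of_le_left h_past hX.comap_le

end CondMean

/-! ### Uniformly distributed frames -/

section Frames

variable {F ι : Type*} [NormedAddCommGroup F] [InnerProductSpace ℝ F] [Fintype ι]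

theorem measurable_frameSq [MeasurableSpace F] [OpensMeasurableSpace F]
    [SecondCountableTopology F] :
    Measurable fun z : (ι → F) × F => frameSq z.1 z.2 :=
  Finset.measurable_fun_sum _ fun i _ =>
    (measurable_snd.inner ((measurable_pi_apply i).comp measurable_fst)).pow_const 2

theorem sum_frameSq_orthonormalBasis {κ : Type*} [Fintype κ] (b : OrthonormalBasis κ ℝ F)
    {v : ι → F} (hv : ∀ i, ‖v i‖ = 1) : ∑ j, frameSq v (b j) = Fintype.card ι := by
  have h_parseval (i : ι) : ∑ j, inner ℝ (b j) (v i) ^ 2 = 1 := by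
    simpa [hv i] using b.sum_sq_norm_inner_right (v i)
  simp only [frameSq]
  rw [Finset.sum_comm]
  simp [h_parseval]

variable {n k : ℕ}

theorem measurable_frameSq_left (u : E n) : Measurable fun v : Fin k → E n => frameSq v u :=
  measurable_frameSq.comp (measurable_id.prodMk measurable_const)

theorem IsStiefelUniform.lintegral_frameSq_eq {ν : Measure (Fin k → E n)}
    (hν : IsStiefelUniform ν) {u w : E n} (huw : ‖u‖ = ‖w‖) :
    ∫⁻ v, ENNReal.ofReal (frameSq v u) ∂ν = ∫⁻ v, ENNReal.ofReal (frameSq v w) ∂ν := by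
  let U : E n ≃ₗᵢ[ℝ] E n := (Submodule.span ℝ {u - w})ᗮ.reflection
  have hU : U u = w := Submodule.reflection_sub huw
  have hU_meas : Measurable fun (v : Fin k → E n) i => U (v i) := by fun_prop
  conv_rhs => rw [← hν.invariant U]
  rw [lintegral_map (measurable_frameSq_left w).ennreal_ofReal hU_meas, ← hU]
  simp_rw [frameSq_map]

theorem IsStiefelUniform.lintegral_frameSq {ν : Measure (Fin k → E n)}
    (hν : IsStiefelUniform ν) {u : E n} (hu : ‖u‖ = 1) :
    ∫⁻ v, ENNReal.ofReal (frameSq v u) ∂ν = ENNReal.ofReal (k / n) := by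
  have hn : 0 < n := Nat.pos_of_ne_zero (by rintro rfl; simp [Subsingleton.elim u 0] at hu)
  have := hν.isProbabilityMeasure
  set b := EuclideanSpace.basisFun (Fin n) ℝ
  have h_sum : ∀ᵐ v ∂ν, ∑ j, ENNReal.ofReal (frameSq v (b j)) = k := by
    filter_upwards [hν.ae_mem] with v hv
    rw [← ENNReal.ofReal_sum_of_nonneg fun _ _ => frameSq_nonneg _ _,
      sum_frameSq_orthonormalBasis b hv.1, Fintype.card_fin, ENNReal.ofReal_natCast]
  have h_mul : n * ∫⁻ v, ENNReal.ofReal (frameSq v u) ∂ν = k := by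
    calc _ = ∑ j, ∫⁻ v, ENNReal.ofReal (frameSq v (b j)) ∂ν := by
          simp_rw [fun j => hν.lintegral_frameSq_eq ((b.norm_eq_one j).trans hu.symm)]
          simp
      _ = ∫⁻ v, ∑ j, ENNReal.ofReal (frameSq v (b j)) ∂ν :=
          (lintegral_finsetSum _ fun j _ => (measurable_frameSq_left (b j)).ennreal_ofReal).symm
      _ = k := by
          rw [lintegral_congr_ae h_sum]
          simp
  rw [ENNReal.ofReal_div_of_pos (by exact_mod_cast hn), ENNReal.ofReal_natCast,
    ENNReal.ofReal_natCast]
  exact (ENNReal.eq_div_iff (by exact_mod_cast hn.ne') (ENNReal.natCast_ne_top n)).2 h_mul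

theorem IsStiefelSample.ae_mem_stiefel {Ω : Type*} [MeasurableSpace Ω] {P : Measure Ω}
    {V : ℕ → Ω → Fin k → E n} (hV : IsStiefelSample P V) : ∀ᵐ ω ∂P, ∀ t, V t ω ∈ stiefel n k :=
  ae_all_iff.2 fun t => ae_of_ae_map (hV.measurable t).aemeasurable (hV.uniform t).ae_mem

theorem IsStiefelSample.hasCondMeanGE_frameSq {Ω : Type*} [MeasurableSpace Ω] {P : Measure Ω}
    [IsFiniteMeasure P] {V : ℕ → Ω → Fin k → E n} (hV : IsStiefelSample P V) {u : ℕ → Ω → E n}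
    (hu : ∀ t, Measurable[pastFiltration hV.measurable t] (u t)) (hu₁ : ∀ t ω, ‖u t ω‖ = 1) :
    HasCondMeanGE P (pastFiltration hV.measurable) (k / n) fun t ω => frameSq (V t ω) (u t ω) where
  measurable_succ t := measurable_frameSq.comp <|
    (measurable_pastFiltration_succ hV.measurable t).prodMk
      ((hu t).mono ((pastFiltration hV.measurable).mono t.le_succ) le_rfl)
  nonneg := ae_of_all _ fun ω t => frameSq_nonneg _ _
  le_one := by
    filter_upwards [hV.ae_mem_stiefel] with ω hω t
    simpa [hu₁ t ω] using frameSq_le_norm_sq (hω t) (u t ω)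
  mul_lintegral_le t Z hZ := by
    have hX : Measurable[pastFiltration hV.measurable t] fun ω => (u t ω, Z ω) := (hu t).prodMk hZ
    have hle := (pastFiltration hV.measurable).le t
    have hF : Measurable fun z : (E n × ENNReal) × (Fin k → E n) =>
        z.1.2 * ENNReal.ofReal (frameSq z.2 z.1.1) :=
      (measurable_snd.comp measurable_fst).mul (measurable_frameSq.comp
        (measurable_snd.prodMk (measurable_fst.comp measurable_fst))).ennreal_ofReal
    refine le_of_eq ?_
    calc ENNReal.ofReal (k / n) * ∫⁻ ω, Z ω ∂P
        = ∫⁻ ω, Z ω * ENNReal.ofReal (k / n) ∂P := by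
          rw [lintegral_mul_const _ (hZ.mono hle le_rfl), mul_comm]
      _ = ∫⁻ ω, ∫⁻ v, Z ω * ENNReal.ofReal (frameSq v (u t ω)) ∂(P.map (V t)) ∂P := by
          refine lintegral_congr fun ω => ?_
          rw [lintegral_const_mul _ (measurable_frameSq_left _).ennreal_ofReal,
            (hV.uniform t).lintegral_frameSq (hu₁ t ω)]
      _ = ∫⁻ ω, Z ω * ENNReal.ofReal (frameSq (V t ω) (u t ω)) ∂P :=
          (lintegral_comp_prodMk_of_indepFun (hX.mono hle le_rfl) (hV.measurable t)
            (indepFun_of_measurable_pastFiltration hV.measurable hV.indep hX) hF).symm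

end Frames

/-! ### The Łojasiewicz inequality -/

section Lojasiewicz

variable {n : ℕ} {θ θ' κ κ' ℓ : ℝ} {f : E n → ℝ} {x : E n}

theorem LojasiewiczAt.mono_const (h : LojasiewiczAt θ κ f x) (hκ : κ ≤ κ') :
    LojasiewiczAt θ κ' f x := by
  obtain ⟨μ, hμ, h_le⟩ := h
  exact ⟨μ, hμ, fun y hy => (h_le y hy).trans (mul_le_mul_of_nonneg_right hκ (norm_nonneg _))⟩

theorem lojasiewiczAt_iff_eventually :
    LojasiewiczAt θ κ f x ↔ ∀ᶠ y in 𝓝 x, |f y - f x| ^ θ ≤ κ * ‖gradient f y‖ := by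
  simp only [LojasiewiczAt, Metric.nhds_basis_closedBall.eventually_iff, mem_closedBall_iff_norm]

theorem LojasiewiczAt.mono_exponent (h : LojasiewiczAt θ κ f x) (hf : ContinuousAt f x)
    (hθ : 0 ≤ θ) (hθ' : θ ≤ θ') : LojasiewiczAt θ' κ f x := by
  rw [lojasiewiczAt_iff_eventually] at h ⊢
  have h_lim : Tendsto (fun y => |f y - f x|) (𝓝 x) (𝓝 0) := by
    simpa using (hf.tendsto.sub_const (f x)).abs
  filter_upwards [h, h_lim.eventually_lt_const one_pos] with y hy h_lt
  exact (Real.rpow_le_rpow_of_exponent_ge' (abs_nonneg _) h_lt.le hθ hθ').trans hy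

theorem IsLojasiewicz.mono (h : IsLojasiewicz θ f) (hθ' : θ ≤ θ') (hθ'₁ : θ' < 1) :
    IsLojasiewicz θ' f := by
  obtain ⟨hθ, -, hf, h_loj⟩ := h
  refine ⟨hθ.trans_le hθ', hθ'₁, hf, fun y hy => ?_⟩
  obtain ⟨κ, hκ, hκy⟩ := h_loj y hy
  exact ⟨κ, hκ, hκy.mono_exponent hf.continuous.continuousAt hθ.le hθ'⟩

theorem LojasiewiczAt.eventually_of_gradient_eq_zero (h : LojasiewiczAt θ κ f x) :
    ∀ᶠ y in 𝓝 x, gradient f y = 0 → LojasiewiczAt θ κ f y := by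
  rw [lojasiewiczAt_iff_eventually] at h
  filter_upwards [h.eventually_nhds] with y hy hy₀
  have h_value : f y = f x := by
    have h_le : |f y - f x| ^ θ ≤ 0 := by simpa [hy₀] using hy.self_of_nhds
    by_contra h_ne
    exact h_le.not_gt (Real.rpow_pos_of_pos (abs_pos.2 (sub_ne_zero.2 h_ne)) θ)
  rwa [lojasiewiczAt_iff_eventually, h_value]

theorem IsLojasiewicz.exists_lojasiewiczAt_of_isCompact (h : IsLojasiewicz θ f)
    (hf : Continuous (gradient f)) {s : Set (E n)} (hs : IsCompact s) :
    ∃ κ, ∀ x ∈ s, gradient f x = 0 → LojasiewiczAt θ κ f x := by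
  refine hs.induction_on (p := fun s => ∃ κ, ∀ x ∈ s, gradient f x = 0 → LojasiewiczAt θ κ f x)
    ⟨0, by simp⟩ (fun s t hst ⟨κ, hκ⟩ => ⟨κ, fun x hx => hκ x (hst hx)⟩) ?_ fun x _ => ?_
  · rintro s t ⟨κ, hκ⟩ ⟨κ', hκ'⟩
    refine ⟨max κ κ', fun x hx hx₀ => ?_⟩
    rcases hx with hx | hx
    · exact (hκ x hx hx₀).mono_const (le_max_left _ _)
    · exact (hκ' x hx hx₀).mono_const (le_max_right _ _)
  · by_cases hx₀ : gradient f x = 0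
    · obtain ⟨κ, -, hκ⟩ := h.2.2.2 x hx₀
      exact ⟨_, mem_nhdsWithin_of_mem_nhds hκ.eventually_of_gradient_eq_zero, κ, fun _ hy => hy⟩
    · exact ⟨_, mem_nhdsWithin_of_mem_nhds (hf.continuousAt.eventually_ne hx₀), 0,
        fun _ hy hy₀ => absurd hy₀ hy⟩

theorem eventually_rpow_le_of_isCompact (hf : Continuous f) (hf' : Continuous (gradient f))
    {s : Set (E n)} (hs : IsCompact s)
    (hκ : ∀ x ∈ s, gradient f x = 0 → LojasiewiczAt θ κ f x) {y : ℕ → E n} (hy : ∀ t, y t ∈ s)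
    (hfy : Tendsto (fun t => f (y t)) atTop (𝓝 ℓ))
    (hgy : Tendsto (fun t => gradient f (y t)) atTop (𝓝 0)) :
    ∀ᶠ t in atTop, |f (y t) - ℓ| ^ θ ≤ κ * ‖gradient f (y t)‖ := by
  by_contra h_not
  obtain ⟨σ, hσ, hσ_not⟩ := extraction_of_frequently_atTop (not_eventually.1 h_not)
  obtain ⟨z, hz, ρ, hρ, h_lim⟩ := hs.tendsto_subseq fun i => hy (σ i)
  have h_sub : Tendsto (fun i => σ (ρ i)) atTop atTop := hσ.tendsto_atTop.comp hρ.tendsto_atTop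
  have hz₀ : gradient f z = 0 :=
    tendsto_nhds_unique ((hf'.tendsto z).comp h_lim) (hgy.comp h_sub)
  have hfz : f z = ℓ := tendsto_nhds_unique ((hf.tendsto z).comp h_lim) (hfy.comp h_sub)
  obtain ⟨i, hi⟩ := (h_lim.eventually (lojasiewiczAt_iff_eventually.1 (hκ z hz hz₀))).exists
  exact hσ_not (ρ i) (hfz ▸ hi)

end Lojasiewicz

/-! ### Random descent -/

section Descent

variable {n : ℕ} {Ω : Type*} {m : MeasurableSpace Ω} {P : Measure Ω} {𝓕 : Filtration ℕ m}
  {q c D A θ : ℝ} {f : E n → ℝ} {w : ℕ → Ω → ℝ} {x : ℕ → Ω → E n}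

theorem IsLojasiewicz.exists_ae_lojasiewiczAt (h : IsLojasiewicz θ f)
    (hf : Continuous (gradient f)) {xInf : Ω → E n}
    (hlim : ∀ᵐ ω ∂P, Tendsto (fun t => x t ω) atTop (𝓝 (xInf ω)) ∧ gradient f (xInf ω) = 0)
    (hunif : HasUniformLojasiewiczConstant θ f ∨ ∃ R : ℝ, ∀ᵐ ω ∂P, ∀ t, ‖x t ω‖ ≤ R) :
    ∃ κ, ∀ᵐ ω ∂P, LojasiewiczAt θ κ f (xInf ω) := by
  rcases hunif with ⟨κ, -, hκ⟩ | ⟨R, hR⟩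
  · exact ⟨κ, hlim.mono fun ω hω => hκ _ hω.2⟩
  · obtain ⟨κ, hκ⟩ := h.exists_lojasiewiczAt_of_isCompact hf (isCompact_closedBall (0 : E n) R)
    refine ⟨κ, ?_⟩
    filter_upwards [hlim, hR] with ω ⟨hω, h_crit⟩ hRω
    exact hκ _ (mem_closedBall_zero_iff.2 (le_of_tendsto' hω.norm hRω)) h_crit

/-- A random sequence `x` adapted to `𝓕` along which `f` decreases, up to a geometrically small
error, by `c` times a random fraction `w t` of the squared gradient norm. In SZGD, `w t` is the
part of the squared gradient that the `t`-th random frame sees. -/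
structure IsProjectedDescent (P : Measure Ω) (𝓕 : Filtration ℕ m) (q c D A : ℝ) (f : E n → ℝ)
    (w : ℕ → Ω → ℝ) (x : ℕ → Ω → E n) : Prop where
  measurable : ∀ t, Measurable[𝓕 t] (x t)
  hasCondMeanGE : HasCondMeanGE P 𝓕 q w
  descent : ∀ᵐ ω ∂P, IsApproxDescent c D (fun t => w t ω) (fun t => ‖gradient f (x t ω)‖)
    fun t => f (x t ω)
  step : ∀ᵐ ω ∂P, ∀ t : ℕ,
    ‖x (t + 1) ω - x t ω‖ ≤ A * (‖gradient f (x t ω)‖ + (1 / 2) ^ t)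

namespace IsProjectedDescent

theorem ae_tendsto_gradient [IsFiniteMeasure P] (hx : IsProjectedDescent P 𝓕 q c D A f w x)
    (hq : 0 < q) (hf : Continuous (gradient f)) :
    ∀ᵐ ω ∂P, BddBelow (Set.range fun t => f (x t ω)) →
      Tendsto (fun t => gradient f (x t ω)) atTop (𝓝 0) := by
  have h_sq := hx.hasCondMeanGE.ae_summable_of_summable_mul hq
    (Y := fun t ω => ‖gradient f (x t ω)‖ ^ 2)
    (fun t => (hf.norm.pow 2).measurable.comp (hx.measurable t)) fun _ _ => sq_nonneg _
  filter_upwards [hx.descent, h_sq] with ω h_descent hω h_bdd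
  rw [tendsto_zero_iff_norm_tendsto_zero]
  simpa using (hω (h_descent.summable_mul_sq h_bdd)).tendsto_atTop_zero.sqrt

theorem ae_summable_norm_gradient [IsFiniteMeasure P]
    (hx : IsProjectedDescent P 𝓕 q c D A f w x) (hq : 0 < q) (hf : ContDiff ℝ 1 f)
    (hloj : IsLojasiewicz θ f) (hbdd : ∀ᵐ ω ∂P, Bornology.IsBounded (Set.range fun t => x t ω)) :
    ∀ᵐ ω ∂P, Summable fun t => ‖gradient f (x t ω)‖ := by
  have hf' := continuous_gradient_of_contDiff hf
  -- The summability of `p t * G t` needs an exponent at least `1 / 2`.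
  have hloj' := hloj.mono (le_max_left θ (1 / 2)) (max_lt hloj.2.1 (by norm_num))
  have h_sum := hx.hasCondMeanGE.ae_summable_of_summable_mul hq
    (Y := fun t ω => ‖gradient f (x t ω)‖)
    (fun t => hf'.norm.measurable.comp (hx.measurable t)) fun _ _ => norm_nonneg _
  filter_upwards [hx.descent, hbdd, hx.ae_tendsto_gradient hq hf', h_sum]
    with ω h_descent h_bdd h_grad hω
  have h_comp : IsCompact (closure (Set.range fun t => x t ω)) := h_bdd.isCompact_closure
  have h_mem (t : ℕ) : x t ω ∈ closure (Set.range fun t => x t ω) := subset_closure ⟨t, rfl⟩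
  have h_below : BddBelow (Set.range fun t => f (x t ω)) :=
    (h_comp.bddBelow_image hf.continuous.continuousOn).mono <|
      Set.range_subset_iff.2 fun t => Set.mem_image_of_mem f (h_mem t)
  obtain ⟨ℓ, hℓ⟩ := h_descent.exists_tendsto h_below
  obtain ⟨κ, hκ⟩ := hloj'.exists_lojasiewiczAt_of_isCompact hf' h_comp
  exact hω (h_descent.summable_mul hℓ (le_max_right _ _) hloj'.2.1
    (eventually_rpow_le_of_isCompact hf.continuous hf' h_comp hκ h_mem hℓ (h_grad h_below)))

theorem ae_exists_tendsto [IsFiniteMeasure P]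
    (hx : IsProjectedDescent P 𝓕 q c D A f w x) (hq : 0 < q) (hf : ContDiff ℝ 1 f)
    (hloj : IsLojasiewicz θ f) (hbdd : ∀ᵐ ω ∂P, Bornology.IsBounded (Set.range fun t => x t ω)) :
    ∀ᵐ ω ∂P, ∃ z, Tendsto (fun t => x t ω) atTop (𝓝 z) ∧ gradient f z = 0 := by
  filter_upwards [hx.ae_summable_norm_gradient hq hf hloj hbdd, hx.step] with ω h_sum h_step
  have h_cauchy : CauchySeq fun t => x t ω := by
    refine cauchySeq_of_summable_dist <|
      ((h_sum.add summable_geometric_two).mul_left A).of_nonneg_of_le (fun _ => dist_nonneg)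
        fun t => ?_
    rw [dist_comm, dist_eq_norm]
    exact h_step t
  obtain ⟨z, hz⟩ := cauchySeq_tendsto_of_complete h_cauchy
  refine ⟨z, hz, tendsto_nhds_unique (((continuous_gradient_of_contDiff hf).tendsto z).comp hz) ?_⟩
  exact tendsto_zero_iff_norm_tendsto_zero.2 h_sum.tendsto_atTop_zero

theorem exists_measurable_limit [IsFiniteMeasure P]
    (hx : IsProjectedDescent P 𝓕 q c D A f w x) (hq : 0 < q) (hf : ContDiff ℝ 1 f)
    (hloj : IsLojasiewicz θ f) (hbdd : ∀ᵐ ω ∂P, Bornology.IsBounded (Set.range fun t => x t ω)) :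
    ∃ xInf : Ω → E n, Measurable xInf ∧
      ∀ᵐ ω ∂P, Tendsto (fun t => x t ω) atTop (𝓝 (xInf ω)) ∧ gradient f (xInf ω) = 0 := by
  have h_conv := hx.ae_exists_tendsto hq hf hloj hbdd
  obtain ⟨xInf, h_meas, h_lim⟩ := measurable_limit_of_tendsto_metrizable_ae
    (fun t => ((hx.measurable t).mono (𝓕.le t) le_rfl).aemeasurable)
    (h_conv.mono fun ω ⟨z, hz, _⟩ => ⟨z, hz⟩)
  refine ⟨xInf, h_meas, ?_⟩
  filter_upwards [h_conv, h_lim] with ω ⟨z, hz, hz₀⟩ hω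
  exact ⟨hω, tendsto_nhds_unique hz hω ▸ hz₀⟩

theorem exists_ae_tendsto_pow_mul_sub [IsProbabilityMeasure P]
    (hx : IsProjectedDescent P 𝓕 q c D A f w x) (hq : 0 < q) (hf : Continuous f) (hθ₀ : 0 ≤ θ)
    (hθ : θ ≤ 1 / 2) (κ : ℝ) :
    ∃ Q : ℝ, 1 < Q ∧ ∀ᵐ ω ∂P, ∀ z, Tendsto (fun t => x t ω) atTop (𝓝 z) →
      LojasiewiczAt θ κ f z →
        Tendsto (fun t : ℕ => Q ^ t * (f (x t ω) - f z)) atTop (𝓝 0) := by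
  obtain ⟨ω₀, hω₀⟩ := hx.descent.exists
  have hc : 0 < c := hω₀.c_pos
  obtain ⟨Q, hQ, h_prod⟩ := hx.hasCondMeanGE.exists_ae_tendsto_pow_mul_prod hq
    (contraction_pos hc κ) (contraction_lt_one hc κ).le
  refine ⟨Q, hQ, ?_⟩
  filter_upwards [hx.descent, h_prod] with ω h_descent hω z hz hκ
  have hκ' := hκ.mono_exponent hf.continuousAt hθ₀ hθ
  exact h_descent.tendsto_pow_mul_sub ((hf.tendsto z).comp hz)
    (hz.eventually (lojasiewiczAt_iff_eventually.1 hκ')) (by linarith) hω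

theorem ae_exists_tendsto_pow_mul_sub [IsProbabilityMeasure P]
    (hx : IsProjectedDescent P 𝓕 q c D A f w x) (hq : 0 < q) (hf : Continuous f) (hθ₀ : 0 ≤ θ)
    (hθ : θ ≤ 1 / 2) :
    ∀ᵐ ω ∂P, ∀ z κ, Tendsto (fun t => x t ω) atTop (𝓝 z) → LojasiewiczAt θ κ f z →
      ∃ Q : ℝ, 1 < Q ∧ Tendsto (fun t : ℕ => Q ^ t * (f (x t ω) - f z)) atTop (𝓝 0) := by
  choose Q hQ h_rate using fun j : ℕ => hx.exists_ae_tendsto_pow_mul_sub hq hf hθ₀ hθ j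
  filter_upwards [ae_all_iff.2 h_rate] with ω hω z κ hz hκ
  obtain ⟨j, hj⟩ := exists_nat_ge κ
  exact ⟨Q j, hQ j, hω j z hz (hκ.mono_const hj)⟩

theorem ae_isBigO_sub [IsFiniteMeasure P]
    (hx : IsProjectedDescent P 𝓕 q c D A f w x) (hq : 0 < q) (hf : Continuous f)
    (hθ : 1 / 2 < θ) (hθ₁ : θ ≤ 1) :
    ∀ᵐ ω ∂P, ∀ z κ, Tendsto (fun t => x t ω) atTop (𝓝 z) → LojasiewiczAt θ κ f z →
      (fun t : ℕ => f (x t ω) - f z) =O[atTop] fun t : ℕ => (t : ℝ) ^ (1 / (1 - 2 * θ)) := by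
  filter_upwards [hx.descent, hx.hasCondMeanGE.ae_hasPosLowerDensity hq]
    with ω h_descent h_density z κ hz hκ
  exact h_descent.isBigO_sub ((hf.tendsto z).comp hz) hθ hθ₁
    (hz.eventually (lojasiewiczAt_iff_eventually.1 hκ)) h_density

end IsProjectedDescent

end Descent

/-! ### The SZGD iterates -/

section Iterates

variable {n k : ℕ} {L η δ₀ δ : ℝ} {f : E n → ℝ}

/-- The unit vector in the direction of `g`, with the default value `e` at `g = 0`. -/
noncomputable def direction (e g : E n) : E n :=
  open Classical in if g = 0 then e else ‖g‖⁻¹ • g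

theorem norm_direction {e : E n} (he : ‖e‖ = 1) (g : E n) : ‖direction e g‖ = 1 := by
  unfold direction
  split_ifs with hg
  · exact he
  · rw [norm_smul, norm_inv, norm_norm, inv_mul_cancel₀ (norm_ne_zero_iff.2 hg)]

theorem norm_smul_direction (e g : E n) : ‖g‖ • direction e g = g := by
  unfold direction
  split_ifs with hg
  · simp [hg]
  · exact smul_inv_smul₀ (norm_ne_zero_iff.2 hg) g

theorem frameSq_direction_mul_norm_sq (v : Fin k → E n) (e g : E n) :
    frameSq v (direction e g) * ‖g‖ ^ 2 = frameSq v g := by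
  rw [mul_comm, ← frameSq_smul, norm_smul_direction]

theorem measurable_direction (e : E n) : Measurable (direction e) :=
  Measurable.ite (measurableSet_singleton 0) measurable_const
    (measurable_norm.inv.smul measurable_id)

theorem continuous_gradEst (hf : Continuous f) (δ : ℝ) :
    Continuous fun z : (Fin k → E n) × E n => gradEst f δ z.1 z.2 := by
  unfold gradEst
  fun_prop

theorem smul_gradEst (η δ : ℝ) (v : Fin k → E n) (x : E n) :
    η • gradEst f δ v x = (η * n / k) • ∑ i, centralDiff f δ x (v i) • v i := by
  simp only [gradEst, centralDiff, Finset.smul_sum, smul_smul]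
  congr! 2
  ring

theorem LSmooth.lipschitzWith_gradient (hf : LSmooth L f) : LipschitzWith L.toNNReal (gradient f) :=
  LipschitzWith.of_dist_le' fun x y => by simpa only [dist_eq_norm] using hf.2 x y

theorem LSmooth.abs_centralDiff_sub_inner_gradient_le (hf : LSmooth L f) (hL : 0 ≤ L)
    (hδ : 0 < δ) (x : E n) {v : E n} (hv : ‖v‖ = 1) :
    |centralDiff f δ x v - inner ℝ (gradient f x) v| ≤ L * δ / 2 := by
  simpa [hL, hv] using SZGD.abs_centralDiff_sub_inner_gradient_le
    (hf.1.differentiable one_ne_zero) hf.lipschitzWith_gradient hδ x v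

theorem LSmooth.norm_smul_gradEst_le (hf : LSmooth L f) (hL : 0 ≤ L) (hη : 0 ≤ η) (hδ : 0 < δ)
    {v : Fin k → E n} (hv : v ∈ stiefel n k) (x : E n) :
    ‖η • gradEst f δ v x‖ ≤ η * n / k * (k * (‖gradient f x‖ + L * δ / 2)) := by
  rw [smul_gradEst, norm_smul, Real.norm_of_nonneg (by positivity)]
  gcongr
  simpa using norm_sum_smul_le hv.1 fun i =>
    hf.abs_centralDiff_sub_inner_gradient_le hL hδ x (hv.1 i)

theorem LSmooth.map_sub_smul_gradEst_le (hf : LSmooth L f) (hL : 0 ≤ L) {h c : ℝ} (hc : 0 < c)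
    (hh_eq : h = η * n / k) (hc_eq : c = h - L * h ^ 2 / 2) (hδ : 0 < δ)
    {v : Fin k → E n} (hv : v ∈ stiefel n k) (x : E n) :
    f (x - η • gradEst f δ v x) ≤ f x - c / 2 * frameSq v (gradient f x)
      + k * ((h ^ 2 / (2 * c) + L * h ^ 2 / 2) * (L * δ / 2) ^ 2) := by
  rw [smul_gradEst, ← hh_eq]
  simpa [hL] using map_sub_smul_sum_le (hf.1.differentiable one_ne_zero) hf.lipschitzWith_gradient
    hc (by simpa [hL] using hc_eq) hv fun i =>
      hf.abs_centralDiff_sub_inner_gradient_le hL hδ x (hv.1 i)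

theorem sub_mul_sq_div_two_pos {h : ℝ} (hL : 0 < L) (hh : 0 < h) (hh' : h < 2 / L) :
    0 < h - L * h ^ 2 / 2 := by
  rw [lt_div_iff₀ hL] at hh'
  nlinarith

theorem LSmooth.exists_isApproxDescent_szgd (hf : LSmooth L f) (hL : 0 < L) (hk : 0 < k)
    (hn : 0 < n) (hδ₀ : 0 < δ₀) (hη : 0 < η) (hη' : η < 2 * k / (L * n)) (x₀ : E n) {e : E n}
    (he : ‖e‖ = 1) :
    ∃ c D, ∀ v : ℕ → Fin k → E n, (∀ t, v t ∈ stiefel n k) →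
      IsApproxDescent c D
        (fun t => frameSq (v t) (direction e (gradient f (szgd f η δ₀ x₀ v t))))
        (fun t => ‖gradient f (szgd f η δ₀ x₀ v t)‖) fun t => f (szgd f η δ₀ x₀ v t) := by
  set h : ℝ := η * n / k with hh_eq
  have hh : 0 < h := by positivity
  have hh' : h < 2 / L := by
    rw [lt_div_iff₀ (by positivity)] at hη'
    rw [hh_eq, div_lt_div_iff₀ (by positivity) hL]
    linarith
  set c : ℝ := h - L * h ^ 2 / 2 with hc_eq
  have hc : 0 < c := sub_mul_sq_div_two_pos hL hh hh'
  refine ⟨c / 2, 2 * (k * ((h ^ 2 / (2 * c) + L * h ^ 2 / 2) * (L * δ₀ / 2) ^ 2)), fun v hv => ?_⟩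
  refine ⟨by positivity, by positivity, fun t => frameSq_nonneg _ _, fun t => ?_,
    fun t => norm_nonneg _, fun t => ?_⟩
  · simpa [norm_direction he] using frameSq_le_norm_sq (hv t) (direction e _)
  · have h_step := hf.map_sub_smul_gradEst_le hL.le hc hh_eq hc_eq
      (δ := δ₀ / 2 ^ t) (by positivity) (hv t) (szgd f η δ₀ x₀ v t)
    rw [frameSq_direction_mul_norm_sq]
    refine h_step.trans_eq ?_
    rw [show (4 : ℝ) = 2 ^ 2 by norm_num, pow_right_comm]
    ring

theorem LSmooth.exists_norm_szgd_succ_sub_le (hf : LSmooth L f) (hL : 0 ≤ L) (hδ₀ : 0 < δ₀)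
    (hη : 0 ≤ η) (x₀ : E n) :
    ∃ A, ∀ v : ℕ → Fin k → E n, (∀ t, v t ∈ stiefel n k) → ∀ t,
      ‖szgd f η δ₀ x₀ v (t + 1) - szgd f η δ₀ x₀ v t‖ ≤
        A * (‖gradient f (szgd f η δ₀ x₀ v t)‖ + (1 / 2) ^ t) := by
  refine ⟨η * n / k * (k * max 1 (L * δ₀ / 2)), fun v hv t => ?_⟩
  rw [szgd, sub_sub_cancel_left, norm_neg]
  refine (hf.norm_smul_gradEst_le hL hη (by positivity) (hv t) _).trans ?_
  rw [mul_assoc (η * n / k), mul_assoc (k : ℝ)]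
  gcongr
  rw [mul_add]
  gcongr
  · exact le_mul_of_one_le_left (norm_nonneg _) (le_max_left _ _)
  · calc L * (δ₀ / 2 ^ t) / 2 = L * δ₀ / 2 * (1 / 2) ^ t := by rw [one_div, inv_pow]; ring
      _ ≤ max 1 (L * δ₀ / 2) * (1 / 2) ^ t := by gcongr; exact le_max_right _ _

variable {Ω : Type*} [MeasurableSpace Ω] {P : Measure Ω} {V : ℕ → Ω → Fin k → E n}

theorem measurable_szgd (hV : ∀ t, Measurable (V t)) (hf : Continuous f) (η δ₀ : ℝ) (x₀ : E n)
    (t : ℕ) : Measurable[pastFiltration hV t] fun ω => szgd f η δ₀ x₀ (fun s => V s ω) t := by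
  induction t with
  | zero => exact measurable_const
  | succ t ih =>
    exact (continuous_snd.sub ((continuous_gradEst hf _).const_smul η)).measurable.comp
      ((measurable_pastFiltration_succ hV t).prodMk
        (ih.mono ((pastFiltration hV).mono t.le_succ) le_rfl))

theorem IsStiefelSample.exists_isProjectedDescent [IsFiniteMeasure P] (hV : IsStiefelSample P V)
    (hf : LSmooth L f) (hL : 0 < L) (hk : 0 < k) (hn : 0 < n) (hδ₀ : 0 < δ₀) (hη : 0 < η)
    (hη' : η < 2 * k / (L * n)) (x₀ : E n) :
    ∃ c D A w, IsProjectedDescent P (pastFiltration hV.measurable) (k / n) c D A f w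
      fun t ω => szgd f η δ₀ x₀ (fun s => V s ω) t := by
  obtain ⟨e, he⟩ : ∃ e : E n, ‖e‖ = 1 := ⟨EuclideanSpace.single ⟨0, hn⟩ 1, by simp⟩
  obtain ⟨c, D, h_descent⟩ := hf.exists_isApproxDescent_szgd hL hk hn hδ₀ hη hη' x₀ he
  obtain ⟨A, h_step⟩ := hf.exists_norm_szgd_succ_sub_le (k := k) hL.le hδ₀ hη.le x₀
  have h_meas := measurable_szgd hV.measurable hf.1.continuous η δ₀ x₀
  refine ⟨c, D, A, _, h_meas, hV.hasCondMeanGE_frameSq (fun t => (measurable_direction e).comp <|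
    (continuous_gradient_of_contDiff hf.1).measurable.comp (h_meas t))
    fun t ω => norm_direction he _, ?_, ?_⟩
  · exact hV.ae_mem_stiefel.mono fun ω hω => h_descent _ hω
  · exact hV.ae_mem_stiefel.mono fun ω hω => h_step _ hω

end Iterates

end SZGD


theorem theorem1_general {n k : ℕ} (hk : 1 ≤ k) (hkn : k ≤ n)
    (f : SZGD.E n → ℝ) (L θ η δ₀ : ℝ) (x₀ : SZGD.E n)
    (hL : 0 < L) (hsmooth : SZGD.LSmooth L f) (hloj : SZGD.IsLojasiewicz θ f)
    (hδ₀ : 0 < δ₀) (hη : 0 < η) (hη' : η < 2 * k / (L * n))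
    {Ω : Type*} [MeasurableSpace Ω] (P : Measure Ω) [IsProbabilityMeasure P]
    (V : ℕ → Ω → Fin k → SZGD.E n) (hV : SZGD.IsStiefelSample P V)
    (x : ℕ → Ω → SZGD.E n)
    (hx : ∀ t ω, x t ω = SZGD.szgd f η δ₀ x₀ (fun s => V s ω) t)
    (hxbdd : ∀ᵐ ω ∂P, Bornology.IsBounded (Set.range fun t => x t ω)) :
    ∃ xInf : Ω → SZGD.E n, Measurable xInf ∧
      (∀ᵐ ω ∂P, Tendsto (fun t => x t ω) atTop (𝓝 (xInf ω)) ∧ gradient f (xInf ω) = 0) ∧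
      (θ ≤ 1 / 2 →
        (∀ᵐ ω ∂P, ∃ Q : ℝ, 1 < Q ∧
          Tendsto (fun t : ℕ => Q ^ t * (f (x t ω) - f (xInf ω))) atTop (𝓝 0)) ∧
        ((SZGD.HasUniformLojasiewiczConstant θ f ∨ ∃ R : ℝ, ∀ᵐ ω ∂P, ∀ t, ‖x t ω‖ ≤ R) →
          ∃ Q : ℝ, 1 < Q ∧ ∀ᵐ ω ∂P,
            Tendsto (fun t : ℕ => Q ^ t * (f (x t ω) - f (xInf ω))) atTop (𝓝 0))) ∧
      (1 / 2 < θ →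
        ∀ᵐ ω ∂P, (fun t : ℕ => f (x t ω) - f (xInf ω)) =O[atTop]
          (fun t : ℕ => (t : ℝ) ^ (1 / (1 - 2 * θ)))) := by
  obtain rfl : x = fun t ω => SZGD.szgd f η δ₀ x₀ (fun s => V s ω) t := funext₂ hx
  have hf := hsmooth.1.continuous
  have hn : 0 < n := hk.trans hkn
  have hq : (0 : ℝ) < k / n := by positivity
  obtain ⟨c, D, A, w, hdesc⟩ := hV.exists_isProjectedDescent hsmooth hL hk hn hδ₀ hη hη' x₀
  obtain ⟨xInf, hmeas, hlim⟩ := hdesc.exists_measurable_limit hq hsmooth.1 hloj hxbdd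
  refine ⟨xInf, hmeas, hlim, fun hθ => ⟨?linear, fun hunif => ?uniform⟩, fun hθ => ?sublinear⟩
  case linear =>
    filter_upwards [hlim, hdesc.ae_exists_tendsto_pow_mul_sub hq hf hloj.1.le hθ]
      with ω ⟨hω, hcrit⟩ hrate
    obtain ⟨κ, -, hκ⟩ := hloj.2.2.2 _ hcrit
    exact hrate _ κ hω hκ
  case uniform =>
    obtain ⟨κ, hκ⟩ := hloj.exists_ae_lojasiewiczAt
      (SZGD.continuous_gradient_of_contDiff hsmooth.1) hlim hunif
    obtain ⟨Q, hQ, hrate⟩ := hdesc.exists_ae_tendsto_pow_mul_sub hq hf hloj.1.le hθ κ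
    refine ⟨Q, hQ, ?_⟩
    filter_upwards [hlim, hκ, hrate] with ω hω hκω hrateω using hrateω _ hω.1 hκω
  case sublinear =>
    filter_upwards [hlim, hdesc.ae_isBigO_sub hq hf hθ hloj.2.1.le] with ω ⟨hω, hcrit⟩ hrate
    obtain ⟨κ, -, hκ⟩ := hloj.2.2.2 _ hcrit
    exact hrate _ κ hω hκ

theorem theorem1 {n k : ℕ} (hk : 1 ≤ k) (hkn : k ≤ n)
    (f : SZGD.E n → ℝ) (L θ η δ₀ : ℝ) (x₀ : SZGD.E n)
    (hL : 0 < L) (hsmooth : SZGD.LSmooth L f) (hloj : SZGD.IsLojasiewicz θ f)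
    (hbdd : BddBelow (Set.range f))
    (hδ₀ : 0 < δ₀) (hδ₀' : δ₀ ≤ 1)
    (hη : 0 < η) (hη' : η < 2 * k / (L * n))
    {Ω : Type*} [MeasurableSpace Ω] (P : Measure Ω) [IsProbabilityMeasure P]
    (V : ℕ → Ω → Fin k → SZGD.E n) (hV : SZGD.IsStiefelSample P V)
    (x : ℕ → Ω → SZGD.E n)
    (hx : ∀ t ω, x t ω = SZGD.szgd f η δ₀ x₀ (fun s => V s ω) t)
    (hxbdd : ∀ᵐ ω ∂P, Bornology.IsBounded (Set.range fun t => x t ω)) :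
    ∃ xInf : Ω → SZGD.E n, Measurable xInf ∧
      -- almost sure convergence to a critical point
      (∀ᵐ ω ∂P, Tendsto (fun t => x t ω) atTop (𝓝 (xInf ω)) ∧ gradient f (xInf ω) = 0) ∧
      -- (a) linear rate
      (θ ≤ 1 / 2 → -1 ≤ L * n * η ^ 2 / (2 * k) - η → L * n * η ^ 2 / (2 * k) - η < 0 →
        (∀ᵐ ω ∂P, ∃ Q : ℝ, 1 < Q ∧
          Tendsto (fun t : ℕ => Q ^ t * (f (x t ω) - f (xInf ω))) atTop (𝓝 0)) ∧
        ((SZGD.HasUniformLojasiewiczConstant θ f ∨ ∃ R : ℝ, ∀ᵐ ω ∂P, ∀ t, ‖x t ω‖ ≤ R) →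
          ∃ Q : ℝ, 1 < Q ∧ ∀ᵐ ω ∂P,
            Tendsto (fun t : ℕ => Q ^ t * (f (x t ω) - f (xInf ω))) atTop (𝓝 0))) ∧
      -- (b) sublinear rate
      (1 / 2 < θ →
        ∀ᵐ ω ∂P, (fun t : ℕ => f (x t ω) - f (xInf ω)) =O[atTop]
          (fun t : ℕ => (t : ℝ) ^ (1 / (1 - 2 * θ)))) := by
  obtain ⟨xInf, hmeas, hlim, hlin, hsub⟩ :=
    theorem1_general hk hkn f L θ η δ₀ x₀ hL hsmooth hloj hδ₀ hη hη' P V hV x hx hxbdd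
  exact ⟨xInf, hmeas, hlim, fun hθ _ _ => hlin hθ, hsub⟩
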